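/- Let $n\ge 1$ be an integer, $k=k(n)=\lceil\sqrt{n+1}\,\rceil$ and $N=(n+1)\binom{n+k}{k}$. For an $(n+1)$-tuple $g=(g_1,\dots,g_{n+1})$ of smooth real functions on an open set $\Omega\subseteq\mathbb{R}^n$ let $$h(g)=\det\begin{pmatrix}\partial_1 g_1&\cdots&\partial_n g_1&g_1\\ \vdots&&\vdots&\vdots\\ \partial_1 g_{n+1}&\cdots&\partial_n g_{n+1}&g_{n+1}\end{pmatrix},$$ let $Z_0(g)=h(g)^{-1}(0)$ and $Z_j(g)=Z_{j-1}(g)\cap(\nabla^j h(g))^{-1}(0)$ for $j\ge1$, and let $\bar g(x)=(\partial^\beta g_l(x))_{1\le l\le n+1,\ |\beta|\le k}\in\mathbb{R}^N$ be the $k$-jet of $g$ at $x$. Let $S_k\subset\mathbb{R}^N$ be the set of jets for which $h$ and all its derivatives of order at most $k-1$ vanish, i.e. the set of all $\bar g(x)$ with $g:\mathbb{R}^n\to\mathbb{R}^{n+1}$ smooth and $x\in Z_{k-1}(g)$ (the derivatives of $h(g)$ of order at most $k-1$ at $x$ depend only on $\bar g(x)$). A subset $S$ of a Euclidean space is called a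 manifold collection of defect $\delta$ if it is a finite disjoint union $S=S_1\cup\dots\cup S_\mu$ of smooth embedded submanifolds, each of codimension at least $\delta$, such that $S_1\cup\dots\cup S_j$ is closed for every $j\in\{1,\dots,\mu\}$. Then: (i) $S_{k}\subset\mathbb{R}^N$ is a manifold collection of defect $n+1$. (ii) For every open $\Omega\subseteq\mathbb{R}^n$, every smooth $g=(g_1,\dots,g_{n+1}):\Omega\to\mathbb{R}^{n+1}$, every compact $K\subset\Omega$ and every $\varepsilon>0$ there is $\alpha=(\alpha_{l,\beta})\in\mathbb{R}^N$ with $|\alpha|<\varepsilon$ such that the perturbation $g_\alpha$ with components $$(g_\alpha)_l(x)=g_l(x)+\sum_{|\beta|\le k}\alpha_{l,\beta}\,x^\beta,\qquad l=1,\dots,n+1,$$ satisfies $Z_{k-1}(g_\alpha)\cap K=\emptyset$. -/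

import Mathlib

open scoped ContDiff

namespace DetGen

/-- `ℝⁿ` with its Euclidean norm. -/
abbrev Rn (n : ℕ) : Type := EuclideanSpace ℝ (Fin n)

/-- `k(n) = ⌈√(n+1)⌉`. -/
noncomputable def kk (n : ℕ) : ℕ := ⌈Real.sqrt ((n : ℝ) + 1)⌉₊

/-- The multi-indices `β ∈ ℕⁿ` with `|β| ≤ k`; every entry of such a `β` is at most `k`, so that
nothing is lost by taking the entries in `{0, …, k}`. -/
abbrev MultiIdx (n k : ℕ) : Type := {β : Fin n → Fin (k + 1) // ∑ i, (β i : ℕ) ≤ k}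

/-- The Euclidean space `ℝ^N`, `N = (n+1) * choose (n+k) k`, of jets of order `k` of `n+1` functions
on `ℝⁿ`: one coordinate for each function and each multi-index of length at most `k`. -/
abbrev JetSpace (n k : ℕ) : Type := EuclideanSpace ℝ (Fin (n + 1) × MultiIdx n k)

/-- The partial derivative `∂_i f`. -/
noncomputable def pd {n : ℕ} (i : Fin n) (f : Rn n → ℝ) : Rn n → ℝ :=
  fun x => fderiv ℝ f x (EuclideanSpace.single i 1)

/-- The partial derivative `∂^β f = ∂_1^{β_1} ⋯ ∂_n^{β_n} f`. -/
noncomputable def mpd {n : ℕ} (β : Fin n → ℕ) (f : Rn n → ℝ) : Rn n → ℝ :=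
  (List.finRange n).foldr (fun i u => (pd i)^[β i] u) f

/-- The map `x ↦ (∂^β g_l (x))` from `ℝⁿ` to the jet space, over all `l` and all `|β| ≤ k`. -/
noncomputable def jet {n : ℕ} (k : ℕ) (g : Fin (n + 1) → Rn n → ℝ) (x : Rn n) : JetSpace n k :=
  WithLp.toLp 2 fun p => mpd (fun i => (p.2.1 i : ℕ)) (g p.1) x

/-- The matrix whose `l`-th row is `(∂_1 g_l, …, ∂_n g_l, g_l)`. -/
noncomputable def gradMatrix {n : ℕ} (g : Fin (n + 1) → Rn n → ℝ) (x : Rn n) :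
    Matrix (Fin (n + 1)) (Fin (n + 1)) ℝ :=
  Matrix.of fun l => Fin.snoc (α := fun _ => ℝ) (fun i => pd i (g l) x) (g l x)

/-- `h(g) = det (∇g_l, g_l)`. -/
noncomputable def h {n : ℕ} (g : Fin (n + 1) → Rn n → ℝ) (x : Rn n) : ℝ :=
  (gradMatrix g x).det

/-- `Z_0(g) = h⁻¹(0)` and `Z_{j+1}(g) = Z_j(g) ∩ (∇^{j+1} h)⁻¹(0)`. -/
noncomputable def Z {n : ℕ} (g : Fin (n + 1) → Rn n → ℝ) : ℕ → Set (Rn n)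
  | 0 => {x | h g x = 0}
  | j + 1 => Z g j ∩ {x | iteratedFDeriv ℝ (j + 1) (h g) x = 0}

/-- The bad set `S_k` of the jets of order `k` of smooth `g` at points at which `h(g)` and its
derivatives up to order `k - 1` vanish (these derivatives depend on the jet only). -/
def badSet (n k : ℕ) : Set (JetSpace n k) :=
  {a | ∃ (g : Fin (n + 1) → Rn n → ℝ) (x : Rn n),
    (∀ l, ContDiff ℝ ∞ (g l)) ∧ jet k g x = a ∧ x ∈ Z g (k - 1)}

/-- `M ⊆ E` is a smooth embedded submanifold of codimension `c`: near each of its points it is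
the zero set of a smooth map to `ℝᶜ` whose derivative is onto. -/
def IsSubmanifoldOfCodim {E : Type*} [NormedAddCommGroup E] [NormedSpace ℝ E]
    (M : Set E) (c : ℕ) : Prop :=
  ∀ p ∈ M, ∃ (U : Set E) (φ : E → Rn c), IsOpen U ∧ p ∈ U ∧ ContDiffOn ℝ ∞ φ U ∧
    (∀ x ∈ U, Function.Surjective (fderiv ℝ φ x)) ∧ M ∩ U = {x ∈ U | φ x = 0}

/-- `S` is a manifold collection of defect `δ`: it splits into finitely many smooth submanifolds
`S_0, …, S_{μ-1}` of codimension at least `δ` such that every `⋃ i ≤ j, S_i` is closed. -/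
def IsManifoldCollection {E : Type*} [NormedAddCommGroup E] [NormedSpace ℝ E]
    (S : Set E) (δ : ℕ) : Prop :=
  ∃ (μ : ℕ) (T : Fin μ → Set E) (c : Fin μ → ℕ),
    S = ⋃ i, T i ∧ Pairwise (fun i j => Disjoint (T i) (T j)) ∧
    (∀ i, IsSubmanifoldOfCodim (T i) (c i)) ∧ (∀ i, δ ≤ c i) ∧
    ∀ j, IsClosed (⋃ i, ⋃ (_ : i ≤ j), T i)

/-- The perturbation `(g_α)_l (x) = g_l (x) + ∑_{|β| ≤ k} α_{l,β} x^β`. -/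
def perturb {n k : ℕ} (g : Fin (n + 1) → Rn n → ℝ) (α : JetSpace n k) :
    Fin (n + 1) → Rn n → ℝ :=
  fun l x => g l x + ∑ β : MultiIdx n k, α (l, β) * ∏ i, x i ^ (β.1 i : ℕ)

end DetGen

/-! The bad set is real algebraic: `h` and its derivatives of order at most k-1 are polynomials in
the k-jet, and every vector of the jet space is the jet of some polynomial map. Two facts then give
(i).

Structure (`isManifoldCollection_zeroSet`). Take polynomials p vanishing on a real algebraic set V
that have a nonzero m×m Jacobian minor somewhere on V, while all (m+1)-minors of polynomials
vanishing on V vanish on V. Where such an m-minor is nonzero, V is a submanifold of codimension m;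
the rest of V is cut out by a strictly larger ideal, so Noetherian induction applies. A bound on the
Hausdorff dimension of V turns into a lower bound on all the codimensions.

Dimension (`dimH_badSet_le`). Jets with g(x) = 0 satisfy n+1 independent linear equations. Otherwise
the last column of the matrix A = (∇g, g) extends to a basis of the column space; let Q be the set
of the remaining columns and r = |Q| ≥ 1. The dependence of these columns costs r² dimensions, which
is enough if r ≥ k, since k² ≥ n+1. If r < k, then h = det A vanishes to order at least r along each
coordinate line. Reducing the columns in Q, dividing them by t and letting t → 0 gives a singular
matrix built from A and ∂_i A (`det_glue_eq_zero`), hence one further condition for each direction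
i. All n directions are used if r = 1, and those outside Q if r ≥ 2; the total is at least n+1. The
restriction avoids conflicts caused by ∂_i∂_j = ∂_j∂_i, so that the equations can be solved in
triangular form (`dimH_le_of_triangular`, `dimH_stratum_le`).

For (ii), the map (x, α) ↦ (jet of g_α at x) is a submersion, already in α. The preimage of the bad
set has dimension at most n + N - (n+1) = N - 1, so its projection to the α-space has dense
complement. A cut-off reduces a general Ω to the case of globally defined g. -/

namespace DetGen

open Set Metric Module Topology

/-! ### Level sets of submersions -/

section Straightening

variable {E F : Type*} [NormedAddCommGroup E] [NormedSpace ℝ E] [FiniteDimensional ℝ E]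
  [NormedAddCommGroup F] [NormedSpace ℝ F] [FiniteDimensional ℝ F]

/-- Near a point with onto derivative, a level set is parametrized by the kernel of the derivative. -/
theorem exists_param_of_surjective_fderiv {φ : E → F} {p : E} {U : Set E} (hU : IsOpen U)
    (hp : p ∈ U) (hφ : ContDiffOn ℝ ∞ φ U) (hs : Function.Surjective (fderiv ℝ φ p))
    (h0 : φ p = 0) :
    ∃ (K : Submodule ℝ E) (π : E →L[ℝ] K) (G : K → E) (r : ℝ) (V : Set E),
      finrank ℝ K + finrank ℝ F = finrank ℝ E ∧ 0 < r ∧ IsOpen V ∧ p ∈ V ∧ V ⊆ U ∧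
      ContDiffOn ℝ 1 G (ball 0 r) ∧ G 0 = p ∧
      (∀ w ∈ ball (0 : K) r, G w ∈ V ∧ φ (G w) = 0 ∧ π (G w - p) = w) ∧
      ∀ x ∈ V, φ x = 0 → ∃ w ∈ ball (0 : K) r, G w = x := by
  set φ' := fderiv ℝ φ p with hφ'
  let K : Submodule ℝ E := LinearMap.ker (φ' : E →ₗ[ℝ] F)
  obtain ⟨π, hπ⟩ := Submodule.ClosedComplemented.of_finiteDimensional K
  have hcp : ContDiffAt ℝ ∞ φ p := hφ.contDiffAt (hU.mem_nhds hp)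
  have hd : HasFDerivAt φ φ' p := (hcp.differentiableAt (by simp)).hasFDerivAt
  -- Pairing φ' with a projection onto its kernel gives an isomorphism, so Ψ = (φ, π(· - p)) is a
  -- local chart in which the level set becomes {0} × K.
  have hbij : Function.Bijective (φ'.prod π) := by
    constructor
    · rw [injective_iff_map_eq_zero]
      intro x hx
      have h1 : φ' x = 0 := congrArg Prod.fst hx
      have h2 : π x = 0 := congrArg Prod.snd hx
      have := hπ ⟨x, h1⟩
      simp only [h2] at this
      exact (congrArg Subtype.val this).symm
    · rintro ⟨y, k⟩
      obtain ⟨x, hx⟩ := hs y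
      refine ⟨x + ((k - π x : K) : E), ?_⟩
      have hk : φ' ((k - π x : K) : E) = 0 := (k - π x).2
      ext1
      · change φ' (x + ((k - π x : K) : E)) = y
        rw [map_add, hk, add_zero, hx]
      · change π (x + ((k - π x : K) : E)) = k
        rw [map_add, hπ, add_sub_cancel]
  let Ψ' : E ≃L[ℝ] F × K :=
    (LinearEquiv.ofBijective (φ'.prod π : E →ₗ[ℝ] F × K) hbij).toContinuousLinearEquiv
  let Ψ : E → F × K := fun x => (φ x, π (x - p))
  have hΨc : ContDiffAt ℝ ∞ Ψ p :=
    hcp.prodMk (π.contDiff.contDiffAt.comp p (contDiffAt_id.sub contDiffAt_const))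
  have hΨd : HasFDerivAt Ψ (Ψ' : E →L[ℝ] F × K) p := by
    have h2 : HasFDerivAt (fun x => π (x - p)) π p := by
      exact π.hasFDerivAt.comp p ((hasFDerivAt_id p).sub_const p)
    exact hd.prodMk h2
  have hΨp : Ψ p = 0 := by simp [Ψ, h0]
  let e := hΨc.toOpenPartialHomeomorph Ψ hΨd (by simp)
  have hes : p ∈ e.source := hΨc.mem_toOpenPartialHomeomorph_source hΨd (by simp)
  have heΨ : ∀ x, e x = Ψ x := fun x => rfl
  have het : (0 : F × K) ∈ e.target := by
    rw [← hΨp]; exact e.map_source hes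
  have hsymm0 : e.symm 0 = p := by rw [← hΨp]; exact e.left_inv hes
  have hinv : ContDiffAt ℝ ∞ e.symm 0 := by
    rw [← hΨp]; exact hΨc.to_localInverse hΨd (by simp)
  have hev1 : ∀ᶠ y in 𝓝 (0 : F × K), ContDiffAt ℝ 1 e.symm y :=
    (hinv.of_le (by exact_mod_cast le_top)).eventually (by simp)
  have hev2 : ∀ᶠ y in 𝓝 (0 : F × K), e.symm y ∈ U := by
    apply hinv.continuousAt.eventually_mem
    rw [hsymm0]; exact hU.mem_nhds hp
  obtain ⟨r, hr, hball⟩ := Metric.eventually_nhds_iff_ball.1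
    (hev1.and (hev2.and (e.open_target.mem_nhds het)))
  have hmem : ∀ w ∈ ball (0 : K) r, ((0 : F), w) ∈ ball (0 : F × K) r := by
    intro w hw
    rw [mem_ball_zero_iff] at hw ⊢
    rw [Prod.norm_mk, norm_zero]
    exact max_lt hr hw
  refine ⟨K, π, fun w => e.symm (0, w), r, (e.source ∩ e ⁻¹' ball 0 r) ∩ U, ?_, hr,
    (e.isOpen_inter_preimage isOpen_ball).inter hU, ⟨⟨hes, ?_⟩, hp⟩, inter_subset_right, ?_, hsymm0,
    ?_, ?_⟩
  · have := Ψ'.toLinearEquiv.finrank_eq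
    rw [finrank_prod] at this
    omega
  · simp [heΨ, hΨp, hr]
  · intro w hw
    exact ((hball _ (hmem w hw)).1.comp w
      (contDiffAt_const.prodMk contDiffAt_id)).contDiffWithinAt
  · intro w hw
    obtain ⟨-, hw2, hw3⟩ := hball _ (hmem w hw)
    have h1 : Ψ (e.symm (0, w)) = (0, w) := e.right_inv hw3
    refine ⟨⟨⟨e.map_target hw3, ?_⟩, hw2⟩, congrArg Prod.fst h1, congrArg Prod.snd h1⟩
    simp only [mem_preimage]
    rw [e.right_inv hw3]
    exact hmem w hw
  · rintro x ⟨⟨hx1, hx2⟩, hx3⟩ hx0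
    refine ⟨π (x - p), ?_, ?_⟩
    · simp only [mem_preimage, heΨ, mem_ball_zero_iff, Ψ, Prod.norm_mk] at hx2
      simpa using lt_of_le_of_lt (le_max_right _ _) hx2
    · have : Ψ x = (0, π (x - p)) := by simp [Ψ, hx0]
      change e.symm (0, π (x - p)) = x
      rw [← this]
      exact e.left_inv hx1

end Straightening

/-! ### Hausdorff dimension of submanifolds -/

section Dimension

variable {E : Type*} [NormedAddCommGroup E] [NormedSpace ℝ E] [FiniteDimensional ℝ E]

/-- Hausdorff dimension can be tested locally, and locally M lies in a C¹ image of a ball in the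
kernel of the derivative of a defining map. -/
theorem IsSubmanifoldOfCodim.dimH_le {M : Set E} {c : ℕ} (hM : IsSubmanifoldOfCodim M c) :
    dimH M ≤ ((finrank ℝ E - c : ℕ) : ENNReal) := by
  by_contra! hlt
  obtain ⟨x, hx, hxt⟩ := exists_mem_nhdsWithin_lt_dimH_of_lt_dimH hlt
  obtain ⟨U, φ, hU, hxU, hφ, hs, hMU⟩ := hM x hx
  have hx0 : φ x = 0 := by
    have : x ∈ M ∩ U := ⟨hx, hxU⟩
    rw [hMU] at this
    exact this.2
  obtain ⟨K, π, G, r, V, hdim, hr, hV, hxV, hVU, hG, -, -, hsurj⟩ :=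
    exists_param_of_surjective_fderiv hU hxU hφ (hs x hxU) hx0
  have hsub : M ∩ V ⊆ G '' ball 0 r := by
    rintro y ⟨hyM, hyV⟩
    have : y ∈ M ∩ U := ⟨hyM, hVU hyV⟩
    rw [hMU] at this
    exact hsurj y hyV this.2
  have h1 := hxt (M ∩ V) (inter_mem_nhdsWithin M (hV.mem_nhds hxV))
  have h2 : dimH (M ∩ V) ≤ finrank ℝ K :=
    ((dimH_mono hsub).trans (hG.dimH_image_le (convex_ball 0 r) subset_rfl)).trans
      ((dimH_mono (subset_univ _)).trans (Real.dimH_univ_eq_finrank K).le)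
  have h3 : finrank ℝ K = finrank ℝ E - c := by
    simp only [finrank_euclideanSpace, Fintype.card_fin] at hdim
    omega
  rw [h3] at h2
  exact absurd h1 (not_lt.2 h2)

/-- The Lipschitz projection π maps M onto a set containing a ball of the tangent space K, and
Lipschitz maps do not raise dimension. The bound on c makes the truncated subtraction a true one. -/
theorem IsSubmanifoldOfCodim.le_dimH {M : Set E} {c : ℕ} (hM : IsSubmanifoldOfCodim M c)
    (hne : M.Nonempty) : c ≤ finrank ℝ E ∧ ((finrank ℝ E - c : ℕ) : ENNReal) ≤ dimH M := by
  obtain ⟨x, hx⟩ := hne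
  obtain ⟨U, φ, hU, hxU, hφ, hs, hMU⟩ := hM x hx
  have hx0 : φ x = 0 := by
    have : x ∈ M ∩ U := ⟨hx, hxU⟩
    rw [hMU] at this
    exact this.2
  obtain ⟨K, π, G, r, V, hdim, hr, hV, hxV, hVU, -, -, hG, -⟩ :=
    exists_param_of_surjective_fderiv hU hxU hφ (hs x hxU) hx0
  simp only [finrank_euclideanSpace, Fintype.card_fin] at hdim
  refine ⟨by omega, ?_⟩
  have hsub : ball (0 : K) r ⊆ (fun y => π (y - x)) '' M := by
    intro w hw
    obtain ⟨h1, h2, h3⟩ := hG w hw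
    have : G w ∈ M ∩ U := by rw [hMU]; exact ⟨hVU h1, h2⟩
    exact ⟨G w, this.1, h3⟩
  have hlip : LipschitzWith ‖π‖₊ (fun y => π (y - x)) := by
    apply LipschitzWith.of_dist_le_mul
    intro a b
    rw [dist_eq_norm, ← map_sub, dist_eq_norm]
    simpa using π.le_opNorm (a - x - (b - x))
  have h3 : finrank ℝ K = finrank ℝ E - c := by omega
  rw [← h3, ← Real.dimH_of_mem_nhds (ball_mem_nhds (0 : K) hr)]
  exact (dimH_mono hsub).trans (hlip.dimH_image_le M)

end Dimension

/-! ### Uniqueness for linear systems -/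

section LinearODE

/-- A solution of a linear system of differential equations that vanishes at `0` vanishes on
`[0, 1]`. -/
theorem eq_zero_of_linear_system {m : ℕ} {F : ℝ → Fin m → ℝ} {A : Fin m → Fin m → ℝ → ℝ}
    (hA : ∀ j i, ContinuousOn (A j i) (Icc 0 1))
    (hF : ∀ t ∈ Icc (0 : ℝ) 1, HasDerivAt F (fun j => ∑ i, A j i t * F t i) t) (h0 : F 0 = 0) :
    F 1 = 0 := by
  have hcont : ContinuousOn (fun t => ∑ j, ∑ i, |A j i t|) (Icc 0 1) :=
    continuousOn_finsetSum _ fun j _ => continuousOn_finsetSum _ fun i _ => (hA j i).abs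
  obtain ⟨C, hC⟩ := (isCompact_Icc.image_of_continuousOn hcont).bddAbove
  refine eq_zero_of_abs_deriv_le_mul_abs_self_of_eq_zero_right (K := C)
    (fun t ht => (hF t ht).continuousAt.continuousWithinAt)
    (fun t ht => (hF t (Ico_subset_Icc_self ht)).hasDerivWithinAt) h0 ?_ 1 (by simp)
  intro t ht
  have hCt : ∑ j, ∑ i, |A j i t| ≤ C := hC ⟨t, Ico_subset_Icc_self ht, rfl⟩
  have hC0 : 0 ≤ C := le_trans (Finset.sum_nonneg fun j _ => Finset.sum_nonneg fun i _ => abs_nonneg _) hCt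
  rw [pi_norm_le_iff_of_nonneg (by positivity)]
  intro j
  calc ‖∑ i, A j i t * F t i‖ ≤ ∑ i, |A j i t| * ‖F t‖ := by
        refine (norm_sum_le _ _).trans (Finset.sum_le_sum fun i _ => ?_)
        rw [norm_mul, Real.norm_eq_abs]
        gcongr
        exact norm_le_pi_norm _ i
    _ = (∑ i, |A j i t|) * ‖F t‖ := by rw [Finset.sum_mul]
    _ ≤ C * ‖F t‖ := by
        gcongr
        refine le_trans ?_ hCt
        exact Finset.single_le_sum (f := fun j => ∑ i, |A j i t|)
          (fun j _ => Finset.sum_nonneg fun i _ => abs_nonneg _) (Finset.mem_univ j)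

end LinearODE

/-! ### Stratification of real algebraic sets -/

section Polynomial

variable {ι : Type*}

/-- The polynomial function of `p` on Euclidean space. -/
noncomputable def polyFun (p : MvPolynomial ι ℝ) (x : EuclideanSpace ℝ ι) : ℝ :=
  MvPolynomial.eval x.ofLp p

/-- The common zeros of the polynomials in `I`. -/
def zeroSet (I : Ideal (MvPolynomial ι ℝ)) : Set (EuclideanSpace ℝ ι) :=
  {x | ∀ p ∈ I, polyFun p x = 0}

/-- The polynomials that vanish on `V`. -/
def idealOf (V : Set (EuclideanSpace ℝ ι)) : Ideal (MvPolynomial ι ℝ) where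
  carrier := {p | ∀ x ∈ V, polyFun p x = 0}
  add_mem' := by
    intro a b ha hb x hx
    simp only [polyFun, map_add]
    rw [← polyFun, ← polyFun, ha x hx, hb x hx, add_zero]
  zero_mem' := by intro x _; simp [polyFun]
  smul_mem' := by
    intro a b hb x hx
    simp only [polyFun, smul_eq_mul, map_mul]
    rw [← polyFun, ← polyFun, hb x hx, mul_zero]

theorem le_idealOf_zeroSet (I : Ideal (MvPolynomial ι ℝ)) : I ≤ idealOf (zeroSet I) :=
  fun p hp _ hx => hx p hp

theorem zeroSet_idealOf_zeroSet (I : Ideal (MvPolynomial ι ℝ)) :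
    zeroSet (idealOf (zeroSet I)) = zeroSet I :=
  Subset.antisymm (fun _ hx p hp => hx p (le_idealOf_zeroSet I hp)) fun x hx _ hp => hp x hx

/-- The minor of the Jacobian matrix of `p` on the columns `s`. -/
noncomputable def jacobianMinor {m : ℕ} (p : Fin m → MvPolynomial ι ℝ) (s : Fin m → ι) :
    MvPolynomial ι ℝ :=
  Matrix.det (Matrix.of fun i j => MvPolynomial.pderiv (s j) (p i))

theorem polyFun_jacobianMinor {m : ℕ} (p : Fin m → MvPolynomial ι ℝ) (s : Fin m → ι)
    (x : EuclideanSpace ℝ ι) :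
    polyFun (jacobianMinor p s) x =
      Matrix.det (Matrix.of fun i j => polyFun (MvPolynomial.pderiv (s j) (p i)) x) := by
  rw [jacobianMinor, polyFun, RingHom.map_det]
  rfl

variable [Fintype ι]

theorem hasFDerivAt_polyFun (p : MvPolynomial ι ℝ) (x : EuclideanSpace ℝ ι) :
    HasFDerivAt (polyFun p)
      (∑ u, polyFun (MvPolynomial.pderiv u p) x • (EuclideanSpace.proj u : _ →L[ℝ] ℝ)) x := by
  classical
  induction p using MvPolynomial.induction_on with
  | C a =>
    have e : polyFun (MvPolynomial.C a : MvPolynomial ι ℝ) = fun _ => a := by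
      ext y; simp [polyFun]
    rw [e]
    refine (hasFDerivAt_const (𝕜 := ℝ) a x).congr_fderiv ?_
    simp [polyFun]
  | add p q hp hq =>
    have h := hp.add hq
    have e : polyFun (p + q) = polyFun p + polyFun q := by
      ext y; simp [polyFun]
    rw [e]
    refine h.congr_fderiv ?_
    simp [polyFun, add_smul, Finset.sum_add_distrib]
  | mul_X p j hp =>
    have h := hp.mul (EuclideanSpace.proj (𝕜 := ℝ) j : EuclideanSpace ℝ ι →L[ℝ] ℝ).hasFDerivAt
    have e : polyFun (p * MvPolynomial.X j) = polyFun p *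
        ⇑(EuclideanSpace.proj (𝕜 := ℝ) j : EuclideanSpace ℝ ι →L[ℝ] ℝ) := by
      ext y; simp [polyFun]
    rw [e]
    refine h.congr_fderiv ?_
    ext v
    simp [polyFun, MvPolynomial.pderiv_X, Pi.single_apply, add_mul,
      Finset.sum_add_distrib, Finset.mul_sum]
    congr 1
    · simp [apply_ite (MvPolynomial.eval x.ofLp)]
    · exact Finset.sum_congr rfl fun i _ => by ring

theorem contDiff_polyFun (p : MvPolynomial ι ℝ) : ContDiff ℝ ∞ (polyFun p) := by
  induction p using MvPolynomial.induction_on with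
  | C a =>
    have e : polyFun (MvPolynomial.C a : MvPolynomial ι ℝ) = fun _ => a := by
      ext y; simp [polyFun]
    rw [e]; exact contDiff_const
  | add p q hp hq =>
    have e : polyFun (p + q) = fun y => polyFun p y + polyFun q y := by
      ext y; simp [polyFun]
    rw [e]; exact hp.add hq
  | mul_X p j hp =>
    have e : polyFun (p * MvPolynomial.X j) = fun y => polyFun p y * y j := by
      ext y; simp [polyFun]
    rw [e]; exact hp.mul (by fun_prop)

theorem continuous_polyFun (p : MvPolynomial ι ℝ) : Continuous (polyFun p) :=
  (contDiff_polyFun p).continuous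

theorem isClosed_zeroSet (I : Ideal (MvPolynomial ι ℝ)) : IsClosed (zeroSet I) := by
  have : zeroSet I = ⋂ p ∈ I, polyFun p ⁻¹' {0} := by ext; simp [zeroSet]
  rw [this]
  exact isClosed_biInter fun p _ => isClosed_singleton.preimage (continuous_polyFun p)

/-- The map with components `p i`. -/
noncomputable def polyMap {m : ℕ} (p : Fin m → MvPolynomial ι ℝ) (x : EuclideanSpace ℝ ι) :
    Rn m :=
  WithLp.toLp 2 fun i => polyFun (p i) x

theorem contDiff_polyMap {m : ℕ} (p : Fin m → MvPolynomial ι ℝ) : ContDiff ℝ ∞ (polyMap p) := by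
  rw [contDiff_euclidean]
  exact fun i => contDiff_polyFun (p i)

theorem fderiv_polyMap_apply {m : ℕ} (p : Fin m → MvPolynomial ι ℝ) (x v : EuclideanSpace ℝ ι)
    (i : Fin m) :
    fderiv ℝ (polyMap p) x v i = ∑ u, polyFun (MvPolynomial.pderiv u (p i)) x * v u := by
  have h : HasFDerivAt (polyMap p) (fderiv ℝ (polyMap p) x) x :=
    ((contDiff_polyMap p).differentiable (by simp) x).hasFDerivAt
  have h1 := ((hasFDerivWithinAt_euclidean (t := univ)).1 h.hasFDerivWithinAt) i
  have h2 := (h1.hasFDerivAt Filter.univ_mem).unique (hasFDerivAt_polyFun (p i) x)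
  have := congrArg (fun L => L v) h2
  simpa using this

theorem surjective_fderiv_polyMap {m : ℕ} (p : Fin m → MvPolynomial ι ℝ) (s : Fin m → ι)
    {x : EuclideanSpace ℝ ι} (hx : polyFun (jacobianMinor p s) x ≠ 0) :
    Function.Surjective (fderiv ℝ (polyMap p) x) := by
  classical
  intro y
  set M : Matrix (Fin m) (Fin m) ℝ :=
    Matrix.of fun i j => polyFun (MvPolynomial.pderiv (s j) (p i)) x with hM
  have hdet : IsUnit M.det := by
    rw [polyFun_jacobianMinor] at hx
    exact isUnit_iff_ne_zero.2 hx
  let c : Fin m → ℝ := M⁻¹.mulVec y.ofLp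
  have hc : M.mulVec c = y.ofLp := by
    simp only [c, Matrix.mulVec_mulVec, Matrix.mul_nonsing_inv M hdet, Matrix.one_mulVec]
  refine ⟨∑ j, c j • EuclideanSpace.single (s j) 1, ?_⟩
  ext i
  rw [map_sum, ← hc]
  simp only [map_smul, Matrix.mulVec, dotProduct, WithLp.ofLp_sum, Finset.sum_apply,
    WithLp.ofLp_smul, Pi.smul_apply, fderiv_polyMap_apply, smul_eq_mul]
  refine Finset.sum_congr rfl fun j _ => ?_
  simp [hM, mul_comm]

/-- Expansion of a bordered minor along its last column. -/
theorem exists_cofactors_bordered {R κ : Type*} [CommRing R] {m : ℕ} (P : Fin m → κ → R)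
    (f : κ → R) (s : Fin m → κ) :
    ∃ e : Fin m → R, ∀ u : κ,
      Matrix.det (Matrix.of fun i j : Fin (m + 1) =>
          (Fin.snoc P f : Fin (m + 1) → κ → R) i ((Fin.snoc s u : Fin (m + 1) → κ) j)) =
        Matrix.det (Matrix.of fun i j => P i (s j)) * f u + ∑ i, e i * P i u := by
  let N : Fin (m + 1) → Matrix (Fin m) (Fin m) R := fun i =>
    Matrix.of fun a b => (Fin.snoc P f : Fin (m + 1) → κ → R) (i.succAbove a) (s b)
  -- Only the last column involves u, so the cofactors along it serve all u at once.
  refine ⟨fun i => (-1) ^ ((i : ℕ) + m) * (N i.castSucc).det, fun u => ?_⟩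
  rw [Matrix.det_succ_column _ (Fin.last m), Fin.sum_univ_castSucc, add_comm]
  have hN : ∀ i : Fin (m + 1), Matrix.submatrix (Matrix.of fun i j : Fin (m + 1) =>
      (Fin.snoc P f : Fin (m + 1) → κ → R) i ((Fin.snoc s u : Fin (m + 1) → κ) j))
      i.succAbove (Fin.last m).succAbove = N i := by
    intro i
    ext a b
    simp [N]
  have hlast : N (Fin.last m) = Matrix.of fun i j => P i (s j) := by
    ext a b
    simp [N]
  congr 1
  · rw [hN, hlast]
    simp only [Fin.val_last, Matrix.of_apply, Fin.snoc_last, ← two_mul, pow_mul]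
    simp [mul_comm]
  · refine Finset.sum_congr rfl fun i _ => ?_
    rw [hN]
    simp only [Fin.val_castSucc, Fin.val_last, Matrix.of_apply, Fin.snoc_last, Fin.snoc_castSucc]
    ring

/-- Where the Jacobian of polynomials `p i` vanishing on `V` has locally maximal rank, `V` is cut
out by the `p i`. -/
theorem exists_nhds_inter_eq {V : Set (EuclideanSpace ℝ ι)} (hV : zeroSet (idealOf V) = V) {m : ℕ}
    (hmax : ∀ p : Fin (m + 1) → MvPolynomial ι ℝ, (∀ i, p i ∈ idealOf V) →
      ∀ s, jacobianMinor p s ∈ idealOf V)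
    {p : Fin m → MvPolynomial ι ℝ} (hp : ∀ i, p i ∈ idealOf V) {s : Fin m → ι}
    {x₀ : EuclideanSpace ℝ ι} (hx₀ : x₀ ∈ V) (hdet : polyFun (jacobianMinor p s) x₀ ≠ 0) :
    ∃ U : Set (EuclideanSpace ℝ ι), IsOpen U ∧ x₀ ∈ U ∧
      (∀ x ∈ U, polyFun (jacobianMinor p s) x ≠ 0) ∧ V ∩ U = {x ∈ U | polyMap p x = 0} := by
  set Δ := jacobianMinor p s with hΔ
  have hpV : ∀ x ∈ V, polyMap p x = 0 := by
    intro x hx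
    ext i
    exact hp i x hx
  obtain ⟨K, π, G, r, U, -, hr, hU, hxU, hUΔ, hG, hG0, hGU, hsurj⟩ :=
    exists_param_of_surjective_fderiv (U := {x | polyFun Δ x ≠ 0})
      (isOpen_compl_singleton.preimage (continuous_polyFun Δ)) hdet
      (contDiff_polyMap p).contDiffOn (surjective_fderiv_polyMap p s hdet) (hpV x₀ hx₀)
  refine ⟨U, hU, hxU, hUΔ, Subset.antisymm (fun x hx => ⟨hx.2, hpV x hx.1⟩) ?_⟩
  rintro x ⟨hxU', hx0⟩
  refine ⟨?_, hxU'⟩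
  obtain ⟨w, hw, rfl⟩ := hsurj x hxU' hx0
  obtain ⟨k, f, hf⟩ := Submodule.fg_iff_exists_fin_generating_family.1
    ((isNoetherianRing_iff_ideal_fg _).1 inferInstance (idealOf V))
  have hfmem : ∀ j, f j ∈ idealOf V := fun j => hf ▸ Submodule.subset_span (mem_range_self j)
  -- the generators satisfy a linear system along paths in the zero set of `p`
  have hbord : ∀ j u, ∃ b : Fin k → MvPolynomial ι ℝ, ∑ i, b i * f i =
      jacobianMinor (Fin.snoc p (f j) : Fin (m + 1) → _) (Fin.snoc s u : Fin (m + 1) → ι) := by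
    intro j u
    have hmem : jacobianMinor (Fin.snoc p (f j) : Fin (m + 1) → _)
        (Fin.snoc s u : Fin (m + 1) → ι) ∈ idealOf V := by
      apply hmax
      intro i
      refine Fin.lastCases ?_ (fun i => ?_) i
      · simpa using hfmem j
      · simpa using hp i
    rw [← hf] at hmem
    obtain ⟨b, hb⟩ := (Submodule.mem_span_range_iff_exists_fun _).1 hmem
    exact ⟨b, hb⟩
  choose b hb using hbord
  -- The bordered minor lies in the ideal, hence is a combination of the f i. Its expansion
  -- therefore expresses Δ ∂_u f_j through the f i, up to multiples of ∂_u p_i; these drop out when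
  -- contracted with a velocity tangent to p = 0 (`htan`).
  have hexp : ∀ j, ∃ e : Fin m → MvPolynomial ι ℝ, ∀ u, ∑ i, b j u i * f i =
      Δ * MvPolynomial.pderiv u (f j) + ∑ i, e i * MvPolynomial.pderiv u (p i) := by
    intro j
    obtain ⟨e, he⟩ := exists_cofactors_bordered (fun i u => MvPolynomial.pderiv u (p i))
      (fun u => MvPolynomial.pderiv u (f j)) s
    refine ⟨e, fun u => ?_⟩
    rw [hb, hΔ, jacobianMinor, jacobianMinor, ← he u]
    congr 1
    ext1 a c
    refine Fin.lastCases ?_ (fun a => ?_) a <;> simp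
  choose e he using hexp
  have hseg : ∀ t ∈ Icc (0 : ℝ) 1, t • w ∈ ball (0 : K) r := by
    intro t ht
    rw [mem_ball_zero_iff] at hw ⊢
    rw [norm_smul, Real.norm_eq_abs, abs_of_nonneg ht.1]
    exact lt_of_le_of_lt (mul_le_of_le_one_left (norm_nonneg _) ht.2) hw
  let γ : ℝ → EuclideanSpace ℝ ι := fun t => G (t • w)
  let v : ℝ → EuclideanSpace ℝ ι := fun t => fderiv ℝ G (t • w) w
  have hγ : ∀ t ∈ Icc (0 : ℝ) 1, HasDerivAt γ (v t) t := by
    intro t ht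
    have h1 : HasFDerivAt G (fderiv ℝ G (t • w)) (t • w) :=
      ((hG.contDiffAt (isOpen_ball.mem_nhds (hseg t ht))).differentiableAt (by simp)).hasFDerivAt
    have h2 : HasDerivAt (fun t : ℝ => t • w) w t := by
      simpa using (hasDerivAt_id t).smul_const w
    exact h1.comp_hasDerivAt t h2
  have hγc : ContinuousOn γ (Icc 0 1) := fun t ht => (hγ t ht).continuousAt.continuousWithinAt
  have hvc : ContinuousOn v (Icc 0 1) := by
    have h1 : ContinuousOn (fderiv ℝ G) (ball 0 r) :=
      hG.continuousOn_fderiv_of_isOpen isOpen_ball (by simp)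
    have h2 : ContinuousOn (fun t : ℝ => fderiv ℝ G (t • w)) (Icc 0 1) :=
      h1.comp (by fun_prop) hseg
    exact h2.clm_apply continuousOn_const
  have hγU : ∀ t ∈ Icc (0 : ℝ) 1, polyFun Δ (γ t) ≠ 0 := fun t ht =>
    hUΔ (hGU _ (hseg t ht)).1
  have hcomp : ∀ (q : MvPolynomial ι ℝ), ∀ t ∈ Icc (0 : ℝ) 1, HasDerivAt (fun t => polyFun q (γ t))
      (∑ u, polyFun (MvPolynomial.pderiv u q) (γ t) * v t u) t := by
    intro q t ht
    have := (hasFDerivAt_polyFun q (γ t)).comp_hasDerivAt t (hγ t ht)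
    simpa using! this
  have htan : ∀ i, ∀ t ∈ Icc (0 : ℝ) 1,
      ∑ u, polyFun (MvPolynomial.pderiv u (p i)) (γ t) * v t u = 0 := by
    intro i t ht
    refine (hcomp (p i) t ht).unique ?_
    have hev : (fun t => polyFun (p i) (γ t)) =ᶠ[𝓝 t] fun _ => 0 := by
      have hc : ContinuousAt (fun t : ℝ => t • w) t := by fun_prop
      filter_upwards [hc.eventually_mem (isOpen_ball.mem_nhds (hseg t ht))] with t' ht'
      exact congrArg (fun y : Rn m => y i) (hGU _ ht').2.1
    exact (hasDerivAt_const t (0 : ℝ)).congr_of_eventuallyEq hev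
  -- Along γ, which joins x₀ to the given point inside p = 0, division by Δ turns these relations
  -- into a linear system for the generators, with initial value 0 because x₀ ∈ V.
  have hzero := eq_zero_of_linear_system (F := fun t j => polyFun (f j) (γ t))
    (A := fun j i t => ∑ u, polyFun (b j u i) (γ t) * v t u / polyFun Δ (γ t)) ?_ ?_ ?_
  · rw [← hV]
    intro q hq
    rw [← hf] at hq
    obtain ⟨a, rfl⟩ := (Submodule.mem_span_range_iff_exists_fun _).1 hq
    have hz : ∀ j, polyFun (f j) (G w) = 0 := fun j => by
      have := congrFun hzero j
      simpa [γ] using this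
    simp only [polyFun] at hz
    simp [polyFun, hz]
  · intro j i
    refine continuousOn_finsetSum _ fun u _ => ContinuousOn.div (ContinuousOn.mul ?_ ?_) ?_ hγU
    · exact (continuous_polyFun _).comp_continuousOn hγc
    · exact (EuclideanSpace.proj (𝕜 := ℝ) u : EuclideanSpace ℝ ι →L[ℝ] ℝ).continuous.comp_continuousOn hvc
    · exact (continuous_polyFun _).comp_continuousOn hγc
  · intro t ht
    rw [hasDerivAt_pi]
    intro j
    convert! hcomp (f j) t ht using 1
    have h1 : ∀ u, ∑ i, polyFun (b j u i) (γ t) * polyFun (f i) (γ t) =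
        polyFun Δ (γ t) * polyFun (MvPolynomial.pderiv u (f j)) (γ t) +
          ∑ i, polyFun (e j i) (γ t) * polyFun (MvPolynomial.pderiv u (p i)) (γ t) := by
      intro u
      have := congrArg (fun q => polyFun q (γ t)) (he j u)
      simpa [polyFun] using this
    have h2 : ∑ u, (∑ i, polyFun (e j i) (γ t) * polyFun (MvPolynomial.pderiv u (p i)) (γ t)) *
        v t u = 0 := by
      simp only [Finset.sum_mul, mul_assoc]
      rw [Finset.sum_comm]
      refine Finset.sum_eq_zero fun i _ => ?_
      rw [← Finset.mul_sum, htan i t ht, mul_zero]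
    have h3 : ∑ u, (∑ i, polyFun (b j u i) (γ t) * polyFun (f i) (γ t)) * v t u =
        polyFun Δ (γ t) * ∑ u, polyFun (MvPolynomial.pderiv u (f j)) (γ t) * v t u := by
      simp only [h1, add_mul, Finset.sum_add_distrib]
      rw [h2, add_zero, Finset.mul_sum]
      simp only [mul_assoc]
    rw [← mul_right_inj' (hγU t ht), ← h3]
    simp only [Finset.sum_mul, Finset.mul_sum]
    rw [Finset.sum_comm]
    refine Finset.sum_congr rfl fun u _ => Finset.sum_congr rfl fun i _ => ?_
    field_simp [hγU t ht]
  · ext j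
    simp only [γ, zero_smul, hG0]
    exact hfmem j x₀ hx₀

/-- A real algebraic set is a manifold collection; its Hausdorff dimension bounds the defect. -/
theorem isManifoldCollection_zeroSet {δ : ℕ} (hδ : δ ≤ Fintype.card ι)
    (I : Ideal (MvPolynomial ι ℝ))
    (hdim : dimH (zeroSet I) ≤ ((Fintype.card ι - δ : ℕ) : ENNReal)) :
    IsManifoldCollection (zeroSet I) δ := by
  induction I using WellFoundedGT.induction with
  | ind I ih =>
  rcases (zeroSet I).eq_empty_or_nonempty with hemp | hne
  · exact ⟨0, Fin.elim0, Fin.elim0, by simp [hemp], fun i => i.elim0, fun i => i.elim0,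
      fun i => i.elim0, fun i => i.elim0⟩
  set V := zeroSet I with hVdef
  have hV : zeroSet (idealOf V) = V := zeroSet_idealOf_zeroSet I
  let Q : ℕ → Prop := fun m => ∃ (p : Fin m → MvPolynomial ι ℝ) (s : Fin m → ι),
    (∀ i, p i ∈ idealOf V) ∧ ∃ x ∈ V, polyFun (jacobianMinor p s) x ≠ 0
  have hQ0 : Q 0 := by
    obtain ⟨x, hx⟩ := hne
    exact ⟨Fin.elim0, Fin.elim0, fun i => i.elim0, x, hx, by simp [jacobianMinor, polyFun]⟩
  have hQn : ¬ Q (Fintype.card ι + 1) := by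
    rintro ⟨p, s, -, x, -, hx⟩
    obtain ⟨i, j, hij, hs⟩ := Fintype.exists_ne_map_eq_of_card_lt s (by simp)
    refine hx ?_
    rw [polyFun_jacobianMinor]
    exact Matrix.det_zero_of_column_eq hij fun a => by simp [hs]
  -- Any place where Q switches from true to false will do; it need not be known that Q is monotone.
  obtain ⟨m, hm, hm1⟩ : ∃ m, Q m ∧ ¬ Q (m + 1) := by
    by_contra! hcon
    have hall : ∀ j, Q j := fun j => Nat.rec hQ0 hcon j
    exact hQn (hall _)
  have hmax : ∀ p : Fin (m + 1) → MvPolynomial ι ℝ, (∀ i, p i ∈ idealOf V) →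
      ∀ s, jacobianMinor p s ∈ idealOf V := by
    intro p hp s x hx
    by_contra hne
    exact hm1 ⟨p, s, hp, x, hx, hne⟩
  let N : Set (MvPolynomial ι ℝ) := {q | ∃ (p : Fin m → MvPolynomial ι ℝ) (s : Fin m → ι),
    (∀ i, p i ∈ idealOf V) ∧ q = jacobianMinor p s}
  let I' := idealOf V ⊔ Ideal.span N
  have hI' : ∀ x, x ∈ zeroSet I' ↔ x ∈ V ∧ ∀ q ∈ N, polyFun q x = 0 := by
    intro x
    constructor
    · intro hx
      refine ⟨hV ▸ fun p hp => hx p (Ideal.mem_sup_left hp), fun q hq => hx q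
        (Ideal.mem_sup_right (Ideal.subset_span hq))⟩
    · rintro ⟨h1, h2⟩
      have : I' ≤ idealOf {x} := by
        refine sup_le (fun p hp => ?_) (Ideal.span_le.2 fun q hq => ?_)
        · rintro _ rfl
          exact hp _ h1
        · rintro _ rfl
          exact h2 q hq
      exact fun p hp => this hp x rfl
  have hlt : I < I' := by
    refine lt_of_le_of_ne ((le_idealOf_zeroSet I).trans le_sup_left) fun heq => ?_
    obtain ⟨p, s, hp, x, hx, hxne⟩ := hm
    refine hxne (((hI' x).1 ?_).2 _ ⟨p, s, hp, rfl⟩)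
    rwa [← heq]
  have hsub : zeroSet I' ⊆ V := fun x hx => ((hI' x).1 hx).1
  obtain ⟨μ, T, c, hT, hdisj, hman, hcod, hclosed⟩ := ih I' hlt ((dimH_mono hsub).trans hdim)
  have hreg : IsSubmanifoldOfCodim (V \ zeroSet I') m := by
    rintro x ⟨hxV, hx⟩
    rw [hI'] at hx
    push Not at hx
    obtain ⟨_, ⟨p, s, hp, rfl⟩, hdet⟩ := hx hxV
    obtain ⟨U, hU, hxU, hUdet, heq⟩ := exists_nhds_inter_eq hV hmax hp hxV hdet
    refine ⟨U, polyMap p, hU, hxU, (contDiff_polyMap p).contDiffOn,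
      fun y hy => surjective_fderiv_polyMap p s (hUdet y hy), ?_⟩
    rw [← heq]
    ext y
    refine ⟨fun hy => ⟨hy.1.1, hy.2⟩, fun hy => ⟨⟨hy.1, fun hyI => ?_⟩, hy.2⟩⟩
    exact hUdet y hy.2 (((hI' y).1 hyI).2 _ ⟨p, s, hp, rfl⟩)
  have hregne : (V \ zeroSet I').Nonempty := by
    obtain ⟨p, s, hp, x, hx, hxne⟩ := hm
    exact ⟨x, hx, fun hxI => hxne (((hI' x).1 hxI).2 _ ⟨p, s, hp, rfl⟩)⟩
  -- The regular part is nonempty, so it has dimension at least card ι - m; comparison with the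
  -- bound for V forces the codimension up to δ.
  have hδm : δ ≤ m := by
    obtain ⟨h1, h2⟩ := hreg.le_dimH hregne
    have h3 := h2.trans ((dimH_mono sdiff_subset).trans hdim)
    rw [finrank_euclideanSpace] at h1 h3
    have h4 : Fintype.card ι - m ≤ Fintype.card ι - δ := by exact_mod_cast h3
    omega
  have hunion : V = ⋃ i, (Fin.snoc T (V \ zeroSet I') : Fin (μ + 1) → Set _) i := by
    ext x
    simp only [mem_iUnion, Fin.exists_fin_succ', Fin.snoc_castSucc, Fin.snoc_last]
    rw [← mem_iUnion, ← hT, mem_sdiff]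
    refine ⟨fun h => ?_, fun h => h.elim (fun h => hsub h) And.left⟩
    tauto
  -- The regular part goes last: the shorter initial unions are closed by induction, and the full
  -- union is the closed set V.
  refine ⟨μ + 1, Fin.snoc T (V \ zeroSet I'), Fin.snoc c m, hunion, ?_, ?_, ?_, ?_⟩
  · have hd : ∀ i, Disjoint (T i) (V \ zeroSet I') := fun i =>
      disjoint_sdiff_right.mono_left (hT ▸ subset_iUnion T i)
    intro i j hij
    induction i using Fin.lastCases with
    | last =>
      induction j using Fin.lastCases with
      | last => exact absurd rfl hij
      | cast j => simpa using (hd j).symm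
    | cast i =>
      induction j using Fin.lastCases with
      | last => simpa using hd i
      | cast j => simpa using hdisj (fun h => hij (by rw [h]))
  · intro i
    induction i using Fin.lastCases with
    | last => simpa using hreg
    | cast i => simpa using hman i
  · intro i
    induction i using Fin.lastCases with
    | last => simpa using hδm
    | cast i => simpa using hcod i
  · intro j
    induction j using Fin.lastCases with
    | last =>
      have : (⋃ i, ⋃ (_ : i ≤ Fin.last μ),
          (Fin.snoc T (V \ zeroSet I') : Fin (μ + 1) → Set _) i) = V := by
        refine Eq.trans ?_ hunion.symm
        simp only [Fin.le_last, iUnion_true]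
      rw [this]
      exact isClosed_zeroSet I
    | cast j =>
      have : (⋃ i, ⋃ (_ : i ≤ j.castSucc),
          (Fin.snoc T (V \ zeroSet I') : Fin (μ + 1) → Set _) i) = ⋃ i, ⋃ (_ : i ≤ j), T i := by
        ext x
        simp only [mem_iUnion, Fin.exists_fin_succ', Fin.snoc_castSucc, Fin.snoc_last,
          Fin.castSucc_le_castSucc_iff, exists_prop, or_iff_left_iff_imp]
        rintro ⟨h, -⟩
        exact absurd h (by simp)
      rw [this]
      exact hclosed j

end Polynomial

/-! ### Calculus of iterated partial derivatives -/

section PartialDerivatives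

variable {n : ℕ}

theorem contDiff_pd (i : Fin n) {f : Rn n → ℝ} (hf : ContDiff ℝ ∞ f) : ContDiff ℝ ∞ (pd i f) :=
  (hf.fderiv_right (m := ∞) (by simp)).clm_apply contDiff_const

theorem contDiff_iterate_pd (i : Fin n) (m : ℕ) {f : Rn n → ℝ} (hf : ContDiff ℝ ∞ f) :
    ContDiff ℝ ∞ ((pd i)^[m] f) := by
  induction m with
  | zero => exact hf
  | succ m ih => rw [Function.iterate_succ_apply']; exact contDiff_pd i ih

theorem pd_comm (i j : Fin n) {f : Rn n → ℝ} (hf : ContDiff ℝ ∞ f) :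
    pd i (pd j f) = pd j (pd i f) := by
  ext x
  have hd : DifferentiableAt ℝ (fderiv ℝ f) x :=
    (hf.fderiv_right (m := ∞) (by simp)).differentiable (by simp) x
  have key : ∀ a b : Fin n, pd a (pd b f) x =
      fderiv ℝ (fderiv ℝ f) x (EuclideanSpace.single a 1) (EuclideanSpace.single b 1) := by
    intro a b
    change fderiv ℝ (fun y => fderiv ℝ f y (EuclideanSpace.single b 1)) x _ = _
    rw [fderiv_clm_apply hd (differentiableAt_const _)]
    simp
  rw [key, key]
  exact (hf.contDiffAt.isSymmSndFDerivAt (by simpa using ENat.LEInfty.out)).eq _ _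

theorem pd_iterate_comm (i j : Fin n) (m : ℕ) {f : Rn n → ℝ} (hf : ContDiff ℝ ∞ f) :
    pd i ((pd j)^[m] f) = (pd j)^[m] (pd i f) := by
  induction m with
  | zero => rfl
  | succ m ih =>
    rw [Function.iterate_succ_apply', pd_comm _ _ (contDiff_iterate_pd j m hf), ih,
      Function.iterate_succ_apply']

theorem contDiff_foldr_pd (l : List (Fin n)) (β : Fin n → ℕ) {f : Rn n → ℝ}
    (hf : ContDiff ℝ ∞ f) : ContDiff ℝ ∞ (l.foldr (fun i u => (pd i)^[β i] u) f) := by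
  induction l with
  | nil => exact hf
  | cons j l ih => exact contDiff_iterate_pd j _ ih

theorem contDiff_mpd (β : Fin n → ℕ) {f : Rn n → ℝ} (hf : ContDiff ℝ ∞ f) :
    ContDiff ℝ ∞ (mpd β f) := contDiff_foldr_pd _ β hf

theorem foldr_pd_congr (l : List (Fin n)) {β γ : Fin n → ℕ} (h : ∀ i ∈ l, β i = γ i)
    (f : Rn n → ℝ) :
    l.foldr (fun i u => (pd i)^[β i] u) f = l.foldr (fun i u => (pd i)^[γ i] u) f := by
  induction l with
  | nil => rfl
  | cons j l ih =>
    simp only [List.foldr_cons]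
    rw [ih fun i hi => h i (List.mem_cons_of_mem _ hi), h j List.mem_cons_self]

theorem pd_foldr_pd (l : List (Fin n)) (hl : l.Nodup) {i : Fin n} (hi : i ∈ l) (β : Fin n → ℕ)
    {f : Rn n → ℝ} (hf : ContDiff ℝ ∞ f) :
    pd i (l.foldr (fun i u => (pd i)^[β i] u) f) =
      l.foldr (fun j u => (pd j)^[(β + Pi.single i 1 : Fin n → ℕ) j] u) f := by
  induction l with
  | nil => simp at hi
  | cons j l ih =>
    rw [List.nodup_cons] at hl
    simp only [List.foldr_cons]
    by_cases hij : i = j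
    · subst hij
      rw [foldr_pd_congr l (γ := β + Pi.single i 1) (β := β), Pi.add_apply, Pi.single_eq_same,
        Function.iterate_succ_apply']
      intro a ha
      have : a ≠ i := fun h => hl.1 (h ▸ ha)
      simp [this]
    · rw [pd_iterate_comm _ _ _ (contDiff_foldr_pd l β hf),
        ih hl.2 ((List.mem_cons.1 hi).resolve_left hij)]
      simp [Ne.symm hij]

theorem pd_mpd (i : Fin n) (β : Fin n → ℕ) {f : Rn n → ℝ} (hf : ContDiff ℝ ∞ f) :
    pd i (mpd β f) = mpd (β + Pi.single i 1) f :=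
  pd_foldr_pd _ (List.nodup_finRange n) (List.mem_finRange i) β hf

theorem mpd_zero (f : Rn n → ℝ) : mpd (0 : Fin n → ℕ) f = f := by
  have : ∀ l : List (Fin n), l.foldr (fun i u => (pd i)^[(0 : Fin n → ℕ) i] u) f = f := by
    intro l
    induction l with
    | nil => rfl
    | cons j l ih => simp
  exact this _

theorem mpd_single (i : Fin n) {f : Rn n → ℝ} (hf : ContDiff ℝ ∞ f) :
    mpd (Pi.single i 1) f = pd i f := by
  have := pd_mpd i 0 hf
  rw [mpd_zero, zero_add] at this
  exact this.symm

/-- The iterated partial derivative along a list of directions. -/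
noncomputable def listPd (L : List (Fin n)) (f : Rn n → ℝ) : Rn n → ℝ := L.foldr pd f

theorem contDiff_listPd (L : List (Fin n)) {f : Rn n → ℝ} (hf : ContDiff ℝ ∞ f) :
    ContDiff ℝ ∞ (listPd L f) := by
  induction L with
  | nil => exact hf
  | cons i L ih => exact contDiff_pd i ih

theorem iteratedFDeriv_apply_single {f : Rn n → ℝ} (hf : ContDiff ℝ ∞ f) (m : ℕ) (x : Rn n)
    (v : Fin m → Fin n) :
    iteratedFDeriv ℝ m f x (fun i => EuclideanSpace.single (v i) 1) = listPd (List.ofFn v) f x := by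
  induction m generalizing x with
  | zero => simp [listPd]
  | succ m ih =>
    have hd : DifferentiableAt ℝ (iteratedFDeriv ℝ m f) x :=
      hf.differentiable_iteratedFDeriv (by exact_mod_cast ENat.natCast_lt_top m) x
    rw [hd.iteratedFDeriv_succ_apply_left', List.ofFn_succ]
    simp only [Fin.tail_def]
    change fderiv ℝ (fun y => iteratedFDeriv ℝ m f y
      (fun i : Fin m => EuclideanSpace.single (v i.succ) 1)) x (EuclideanSpace.single (v 0) 1) = _
    simp only [ih]
    rfl

/-- A multilinear map is determined by its values on basis vectors, which here are the partial
derivatives along lists of directions. -/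
theorem iteratedFDeriv_eq_zero_iff {f : Rn n → ℝ} (hf : ContDiff ℝ ∞ f) (m : ℕ) (x : Rn n) :
    iteratedFDeriv ℝ m f x = 0 ↔ ∀ L : List (Fin n), L.length = m → listPd L f x = 0 := by
  constructor
  · rintro h L rfl
    have := iteratedFDeriv_apply_single hf L.length x L.get
    rw [h, List.ofFn_get] at this
    simpa using this.symm
  · intro h
    apply ContinuousMultilinearMap.toMultilinearMap_injective
    refine Module.Basis.ext_multilinear (fun _ => (EuclideanSpace.basisFun (Fin n) ℝ).toBasis) ?_
    intro v
    have := iteratedFDeriv_apply_single hf m x v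
    rw [h _ (by simp)] at this
    simpa using this

end PartialDerivatives

/-! ### Derivatives of monomials -/

section Monomials

variable {n : ℕ}

theorem contDiff_prod_apply {u : Fin n → ℝ → ℝ} (hu : ∀ j, ContDiff ℝ ∞ (u j)) :
    ContDiff ℝ ∞ (fun x : Rn n => ∏ j, u j (x j)) :=
  contDiff_prod fun j _ => (hu j).comp (by fun_prop)

theorem pd_prod_apply (i : Fin n) {u : Fin n → ℝ → ℝ} (hu : ∀ j, ContDiff ℝ ∞ (u j)) :
    pd i (fun x : Rn n => ∏ j, u j (x j)) =
      fun x => ∏ j, Function.update u i (deriv (u i)) j (x j) := by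
  ext x
  have hd : DifferentiableAt ℝ (fun x : Rn n => ∏ j, u j (x j)) x :=
    (contDiff_prod_apply hu).differentiable (by simp) x
  rw [pd, ← hd.lineDeriv_eq_fderiv, lineDeriv]
  have h1 : ∀ t : ℝ, ∏ j, u j ((x + t • EuclideanSpace.single i (1 : ℝ) : Rn n) j) =
      u i (x i + t) * ∏ j ∈ Finset.univ.erase i, u j (x j) := by
    intro t
    rw [← Finset.mul_prod_erase _ _ (Finset.mem_univ i)]
    congr 1
    · simp
    · refine Finset.prod_congr rfl fun j hj => ?_
      simp [Finset.ne_of_mem_erase hj]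
  simp only [h1]
  rw [← Finset.mul_prod_erase _ _ (Finset.mem_univ i), deriv_mul_const, deriv_comp_const_add]
  · simp only [add_zero, Function.update_self]
    congr 1
    refine Finset.prod_congr rfl fun j hj => ?_
    rw [Function.update_of_ne (Finset.ne_of_mem_erase hj)]
  · exact DifferentiableAt.comp (f := fun t => x i + t) 0 ((hu i).differentiable (by simp) _)
      (by fun_prop)

theorem contDiff_iterate_deriv (m : ℕ) {f : ℝ → ℝ} (hf : ContDiff ℝ ∞ f) :
    ContDiff ℝ ∞ (deriv^[m] f) := by
  induction m with
  | zero => exact hf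
  | succ m ih =>
    rw [Function.iterate_succ_apply']
    exact (contDiff_infty_iff_deriv.1 ih).2

theorem iterate_pd_prod_apply (i : Fin n) (m : ℕ) {u : Fin n → ℝ → ℝ}
    (hu : ∀ j, ContDiff ℝ ∞ (u j)) :
    (pd i)^[m] (fun x : Rn n => ∏ j, u j (x j)) =
      fun x => ∏ j, Function.update u i (deriv^[m] (u i)) j (x j) := by
  induction m with
  | zero => simp
  | succ m ih =>
    rw [Function.iterate_succ_apply', ih, pd_prod_apply]
    · simp only [Function.update_idem, Function.update_self, Function.iterate_succ_apply']
    · intro j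
      by_cases hj : j = i
      · subst hj
        simpa using contDiff_iterate_deriv m (hu j)
      · simpa [hj] using hu j

theorem foldr_pd_prod_apply (l : List (Fin n)) (hl : l.Nodup) (β : Fin n → ℕ) {u : Fin n → ℝ → ℝ}
    (hu : ∀ j, ContDiff ℝ ∞ (u j)) :
    l.foldr (fun i u => (pd i)^[β i] u) (fun x : Rn n => ∏ j, u j (x j)) =
      fun x => ∏ j, (if j ∈ l then deriv^[β j] (u j) else u j) (x j) := by
  induction l with
  | nil => simp
  | cons i l ih =>
    rw [List.nodup_cons] at hl
    rw [List.foldr_cons, ih hl.2, iterate_pd_prod_apply]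
    · ext x
      refine Finset.prod_congr rfl fun j _ => ?_
      by_cases hj : j = i
      · subst hj
        simp [hl.1]
      · simp [hj]
    · intro j
      split_ifs
      · exact contDiff_iterate_deriv _ (hu j)
      · exact hu j

/-- The value at `x` of the derivative `∂^γ` of the monomial `x^β`. -/
noncomputable def monoDeriv (β γ : Fin n → ℕ) (x : Rn n) : ℝ :=
  ∏ j, (∏ t ∈ Finset.range (γ j), ((β j : ℝ) - t)) * x j ^ (β j - γ j)

theorem mpd_monomial (β γ : Fin n → ℕ) :
    mpd γ (fun x : Rn n => ∏ j, x j ^ β j) = monoDeriv β γ := by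
  have h := foldr_pd_prod_apply (List.finRange n) (List.nodup_finRange n) γ
    (u := fun j t => t ^ β j) (fun j => contDiff_id.pow _)
  rw [mpd, h]
  ext x
  simp [monoDeriv]

theorem contDiff_monoDeriv (β γ : Fin n → ℕ) : ContDiff ℝ ∞ (monoDeriv β γ) := by
  unfold monoDeriv
  fun_prop

/-- Some coordinate is differentiated more often than its exponent, so the falling factorial there
contains the factor 0. This makes the jets of monomials triangular with respect to degree. -/
theorem monoDeriv_eq_zero {β γ : Fin n → ℕ} (hsum : ∑ i, β i ≤ ∑ i, γ i) (hne : β ≠ γ)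
    (x : Rn n) : monoDeriv β γ x = 0 := by
  obtain ⟨j, hj⟩ : ∃ j, β j < γ j := by
    by_contra! hle
    refine hne (funext fun i => ?_)
    have := (Finset.sum_eq_sum_iff_of_le (fun i _ => hle i)).1
      (le_antisymm (Finset.sum_le_sum fun i _ => hle i) hsum)
    exact (this i (Finset.mem_univ i)).symm
  refine Finset.prod_eq_zero (Finset.mem_univ j) ?_
  rw [Finset.prod_eq_zero (Finset.mem_range.2 hj) (sub_self _), zero_mul]

theorem monoDeriv_self_ne_zero (β : Fin n → ℕ) (x : Rn n) : monoDeriv β β x ≠ 0 := by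
  refine Finset.prod_ne_zero_iff.2 fun j _ => ?_
  simp only [tsub_self, pow_zero, mul_one]
  refine Finset.prod_ne_zero_iff.2 fun t ht => ?_
  have : (t : ℝ) < β j := by exact_mod_cast Finset.mem_range.1 ht
  linarith

theorem pd_add_sum {B : Type*} [Fintype B] (i : Fin n) {f : Rn n → ℝ} (hf : ContDiff ℝ ∞ f)
    (c : B → ℝ) {F : B → Rn n → ℝ} (hF : ∀ b, ContDiff ℝ ∞ (F b)) :
    pd i (fun x => f x + ∑ b, c b * F b x) = fun x => pd i f x + ∑ b, c b * pd i (F b) x := by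
  ext x
  have h1 := (hf.differentiable (by simp) x).hasFDerivAt
  have h2 : ∀ b, HasFDerivAt (fun x => c b * F b x) (c b • fderiv ℝ (F b) x) x := fun b =>
    ((hF b).differentiable (by simp) x).hasFDerivAt.const_mul (c b)
  have h3 := h1.add (HasFDerivAt.fun_sum (u := Finset.univ) fun b _ => h2 b)
  have h4 := congrArg (fun T => T (EuclideanSpace.single i (1 : ℝ))) h3.fderiv
  simpa [pd] using! h4

theorem foldr_pd_add_sum {B : Type*} [Fintype B] (l : List (Fin n)) (β : Fin n → ℕ) {f : Rn n → ℝ}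
    (hf : ContDiff ℝ ∞ f) (c : B → ℝ) {F : B → Rn n → ℝ} (hF : ∀ b, ContDiff ℝ ∞ (F b)) :
    l.foldr (fun i u => (pd i)^[β i] u) (fun x => f x + ∑ b, c b * F b x) =
      fun x => l.foldr (fun i u => (pd i)^[β i] u) f x +
        ∑ b, c b * l.foldr (fun i u => (pd i)^[β i] u) (F b) x := by
  induction l with
  | nil => rfl
  | cons j l ih =>
    simp only [List.foldr_cons]
    rw [ih]
    generalize β j = m
    induction m with
    | zero => rfl
    | succ m ihm =>
      simp only [Function.iterate_succ_apply']
      rw [ihm, pd_add_sum j (contDiff_iterate_pd _ _ (contDiff_foldr_pd l β hf)) c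
        fun b => contDiff_iterate_pd _ _ (contDiff_foldr_pd l β (hF b))]

theorem mpd_add_sum {B : Type*} [Fintype B] (β : Fin n → ℕ) {f : Rn n → ℝ}
    (hf : ContDiff ℝ ∞ f) (c : B → ℝ) {F : B → Rn n → ℝ} (hF : ∀ b, ContDiff ℝ ∞ (F b)) :
    mpd β (fun x => f x + ∑ b, c b * F b x) = fun x => mpd β f x + ∑ b, c b * mpd β (F b) x :=
  foldr_pd_add_sum _ β hf c hF

end Monomials

/-! ### Polynomial perturbations realize all jets -/

section JetsOfPerturbations

variable {n k : ℕ}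

theorem contDiff_monomial (β : Fin n → ℕ) : ContDiff ℝ ∞ (fun x : Rn n => ∏ j, x j ^ β j) := by
  fun_prop

theorem contDiff_perturb {g : Fin (n + 1) → Rn n → ℝ} (hg : ∀ l, ContDiff ℝ ∞ (g l))
    (α : JetSpace n k) (l : Fin (n + 1)) : ContDiff ℝ ∞ (perturb g α l) := by
  unfold perturb
  exact (hg l).add (ContDiff.sum fun β _ => contDiff_const.mul (contDiff_monomial _))

/-- The jet at `x` of the polynomial map with coefficients `α`. -/
noncomputable def polyJet (x : Rn n) : JetSpace n k →ₗ[ℝ] JetSpace n k where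
  toFun α := WithLp.toLp 2 fun p =>
    ∑ β : MultiIdx n k, α (p.1, β) * monoDeriv (fun i => (β.1 i : ℕ)) (fun i => (p.2.1 i : ℕ)) x
  map_add' a b := by
    ext p
    simp [add_mul, Finset.sum_add_distrib]
  map_smul' c a := by
    ext p
    simp [Finset.mul_sum, mul_assoc]

theorem jet_perturb {g : Fin (n + 1) → Rn n → ℝ} (hg : ∀ l, ContDiff ℝ ∞ (g l))
    (α : JetSpace n k) (x : Rn n) : jet k (perturb g α) x = jet k g x + polyJet x α := by
  ext p
  have h := mpd_add_sum (fun i => (p.2.1 i : ℕ)) (hg p.1) (fun β : MultiIdx n k => α (p.1, β))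
    (F := fun β x => ∏ i, x i ^ (β.1 i : ℕ)) fun β => contDiff_monomial _
  have h2 := congrFun h x
  simp only [mpd_monomial] at h2
  exact h2

theorem polyJet_injective (x : Rn n) : Function.Injective (polyJet (k := k) x) := by
  rw [injective_iff_map_eq_zero]
  intro α hα
  -- Descending induction on the degree: once the coefficients of higher degree vanish, the
  -- derivative ∂^β sees only the coefficient of x^β.
  have key : ∀ m : ℕ, ∀ (l : Fin (n + 1)) (β : MultiIdx n k),
      k < (∑ i, (β.1 i : ℕ)) + m → α (l, β) = 0 := by
    intro m
    induction m with
    | zero => intro l β h; exact absurd β.2 (by omega)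
    | succ m ih =>
      intro l β h
      have h1 : ∑ γ : MultiIdx n k, α (l, γ) *
          monoDeriv (fun i => (γ.1 i : ℕ)) (fun i => (β.1 i : ℕ)) x = 0 :=
        congrArg (fun a : JetSpace n k => a (l, β)) hα
      rw [Finset.sum_eq_single β] at h1
      · exact (mul_eq_zero.1 h1).resolve_right (monoDeriv_self_ne_zero _ _)
      · intro γ _ hγ
        by_cases hle : ∑ i, (γ.1 i : ℕ) ≤ ∑ i, (β.1 i : ℕ)
        · rw [monoDeriv_eq_zero hle, mul_zero]
          intro heq
          exact hγ (Subtype.ext (funext fun i => Fin.ext (congrFun heq i)))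
        · rw [ih l γ (by omega), zero_mul]
      · simp
  ext p
  exact key (k + 1) p.1 p.2 (by omega)

theorem polyJet_surjective (x : Rn n) : Function.Surjective (polyJet (k := k) x) :=
  LinearMap.surjective_of_injective (polyJet_injective x)

theorem exists_jet_eq (x : Rn n) (a : JetSpace n k) :
    ∃ g : Fin (n + 1) → Rn n → ℝ, (∀ l, ContDiff ℝ ∞ (g l)) ∧ jet k g x = a := by
  obtain ⟨α, hα⟩ := polyJet_surjective x (a - jet k (fun _ _ => 0) x)
  have h0 : ∀ _ : Fin (n + 1), ContDiff ℝ ∞ (fun _ : Rn n => (0 : ℝ)) := fun _ => contDiff_const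
  exact ⟨perturb (fun _ _ => 0) α, contDiff_perturb h0 α, by rw [jet_perturb h0, hα]; abel⟩

end JetsOfPerturbations

/-! ### The bad set as a real algebraic set -/

section TotalDerivatives

variable {n : ℕ}

/-- Polynomials in the derivatives of all orders of `n + 1` functions on `ℝⁿ`. -/
abbrev JetPoly (n : ℕ) : Type := MvPolynomial (Fin (n + 1) × (Fin n → ℕ)) ℝ

/-- All derivatives of `g` at `x`. -/
noncomputable def jetVal (g : Fin (n + 1) → Rn n → ℝ) (x : Rn n) :
    Fin (n + 1) × (Fin n → ℕ) → ℝ :=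
  fun p => mpd p.2 (g p.1) x

/-- The formal total derivative in direction `i`. -/
noncomputable def totalD (i : Fin n) : Derivation ℝ (JetPoly n) (JetPoly n) :=
  MvPolynomial.mkDerivation ℝ fun p => MvPolynomial.X (p.1, p.2 + Pi.single i 1)

theorem contDiff_eval_jetVal {g : Fin (n + 1) → Rn n → ℝ} (hg : ∀ l, ContDiff ℝ ∞ (g l))
    (P : JetPoly n) : ContDiff ℝ ∞ (fun x => MvPolynomial.eval (jetVal g x) P) := by
  induction P using MvPolynomial.induction_on with
  | C a => simpa using contDiff_const
  | add p q hp hq => simpa using hp.add hq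
  | mul_X p j hp =>
    simp only [map_mul, MvPolynomial.eval_X]
    exact hp.mul (contDiff_mpd j.2 (hg j.1))

theorem pd_eval_jetVal {g : Fin (n + 1) → Rn n → ℝ} (hg : ∀ l, ContDiff ℝ ∞ (g l)) (i : Fin n)
    (P : JetPoly n) :
    pd i (fun x => MvPolynomial.eval (jetVal g x) P) =
      fun x => MvPolynomial.eval (jetVal g x) (totalD i P) := by
  induction P using MvPolynomial.induction_on with
  | C a =>
    ext x
    simp [pd, totalD]
  | add p q hp hq =>
    ext x
    have hp' := ((contDiff_eval_jetVal hg p).differentiable (by simp) x)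
    have hq' := ((contDiff_eval_jetVal hg q).differentiable (by simp) x)
    simp only [map_add]
    rw [← congrFun hp x, ← congrFun hq x, pd, fderiv_fun_add hp' hq']
    rfl
  | mul_X p j hp =>
    ext x
    have hp' := ((contDiff_eval_jetVal hg p).differentiable (by simp) x)
    have hq' := ((contDiff_mpd j.2 (hg j.1)).differentiable (by simp) x)
    have h1 : ∀ x, MvPolynomial.eval (jetVal g x) (p * MvPolynomial.X j) =
        MvPolynomial.eval (jetVal g x) p * mpd j.2 (g j.1) x := by
      intro x; simp [jetVal]
    have h2 := congrFun (pd_mpd i j.2 (hg j.1)) x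
    have h3 := congrFun hp x
    have h4 : totalD i (MvPolynomial.X j : JetPoly n) = MvPolynomial.X (j.1, j.2 + Pi.single i 1) :=
      MvPolynomial.mkDerivation_X _ _ _
    simp only [h1]
    rw [Derivation.leibniz, h4, pd, fderiv_fun_mul hp' hq']
    simp only [smul_eq_mul, map_add, map_mul, MvPolynomial.eval_X, add_apply, smul_apply]
    simp only [jetVal]
    rw [← h2]
    change _ = _ + _ * MvPolynomial.eval (jetVal g x) (totalD i p)
    rw [← h3]
    rfl

/-- The determinant `h` as a polynomial in the derivatives. -/
noncomputable def hPoly (n : ℕ) : JetPoly n :=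
  Matrix.det (Matrix.of fun l => (Fin.snoc (α := fun _ => JetPoly n)
    (fun i => MvPolynomial.X (l, Pi.single i 1)) (MvPolynomial.X (l, 0)) : Fin (n + 1) → JetPoly n))

theorem h_eq_eval {g : Fin (n + 1) → Rn n → ℝ} (hg : ∀ l, ContDiff ℝ ∞ (g l)) :
    h g = fun x => MvPolynomial.eval (jetVal g x) (hPoly n) := by
  ext x
  rw [hPoly, RingHom.map_det, h]
  congr 1
  ext l j
  refine Fin.lastCases ?_ (fun i => ?_) j
  · simp [gradMatrix, jetVal, mpd_zero]
  · simp [gradMatrix, jetVal, mpd_single i (hg l)]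

theorem contDiff_h {g : Fin (n + 1) → Rn n → ℝ} (hg : ∀ l, ContDiff ℝ ∞ (g l)) :
    ContDiff ℝ ∞ (h g) := by
  rw [h_eq_eval hg]
  exact contDiff_eval_jetVal hg _

/-- The iterated formal total derivative of the determinant. -/
noncomputable def hDeriv (L : List (Fin n)) : JetPoly n :=
  L.foldr (fun i P => totalD i P) (hPoly n)

theorem listPd_h {g : Fin (n + 1) → Rn n → ℝ} (hg : ∀ l, ContDiff ℝ ∞ (g l)) (L : List (Fin n)) :
    listPd L (h g) = fun x => MvPolynomial.eval (jetVal g x) (hDeriv L) := by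
  induction L with
  | nil => exact h_eq_eval hg
  | cons i L ih =>
    change pd i (listPd L (h g)) = _
    rw [ih, pd_eval_jetVal hg]
    rfl

theorem mem_Z_iff {g : Fin (n + 1) → Rn n → ℝ} (hg : ∀ l, ContDiff ℝ ∞ (g l)) (m : ℕ) (x : Rn n) :
    x ∈ Z g m ↔ ∀ L : List (Fin n), L.length ≤ m → listPd L (h g) x = 0 := by
  induction m with
  | zero =>
    simp only [Z, mem_ofPred_eq, nonpos_iff_eq_zero, List.length_eq_zero_iff]
    exact ⟨fun h L hL => by rw [hL]; exact h, fun h => h [] rfl⟩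
  | succ m ih =>
    simp only [Z, mem_inter_iff, mem_ofPred_eq, ih, iteratedFDeriv_eq_zero_iff (contDiff_h hg)]
    refine ⟨fun h L hL => ?_, fun h => ⟨fun L hL => h L (by omega), fun L hL => h L hL.le⟩⟩
    rcases Nat.le_or_eq_of_le_succ hL with hL | hL
    · exact h.1 L hL
    · exact h.2 L hL

/-- The derivatives of order at most `k`. -/
def orderLE (n k : ℕ) : Set (Fin (n + 1) × (Fin n → ℕ)) := {p | ∑ i, p.2 i ≤ k}

theorem totalD_mem_supported (i : Fin n) {k : ℕ} {P : JetPoly n}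
    (hP : P ∈ MvPolynomial.supported ℝ (orderLE n k)) :
    totalD i P ∈ MvPolynomial.supported ℝ (orderLE n (k + 1)) := by
  have hmono : MvPolynomial.supported ℝ (orderLE n k) ≤
      MvPolynomial.supported ℝ (orderLE n (k + 1)) :=
    MvPolynomial.supported_mono fun p hp => le_trans hp (Nat.le_succ k)
  rw [MvPolynomial.supported_eq_adjoin_X] at hP
  induction hP using Algebra.adjoin_induction with
  | mem P hP =>
    obtain ⟨p, hp, rfl⟩ := hP
    rw [totalD, MvPolynomial.mkDerivation_X, MvPolynomial.X_mem_supported]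
    simp only [orderLE, mem_ofPred_eq, Pi.add_apply, Finset.sum_add_distrib] at hp ⊢
    rw [Finset.sum_pi_single']
    simpa using hp
  | algebraMap r => simp
  | add P Q _ _ hP hQ => rw [map_add]; exact add_mem hP hQ
  | mul P Q hP' hQ' hP hQ =>
    rw [Derivation.leibniz, smul_eq_mul, smul_eq_mul]
    exact add_mem (mul_mem (hmono hP') hQ) (mul_mem (hmono hQ') hP)

theorem hPoly_mem_supported : hPoly n ∈ MvPolynomial.supported ℝ (orderLE n 1) := by
  rw [hPoly, Matrix.det_apply']
  refine sum_mem fun σ _ => ?_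
  refine mul_mem (intCast_mem _ _) (prod_mem fun l _ => ?_)
  rw [Matrix.of_apply]
  refine Fin.lastCases ?_ (fun i => ?_) l
  · rw [Fin.snoc_last, MvPolynomial.X_mem_supported]
    simp [orderLE]
  · rw [Fin.snoc_castSucc, MvPolynomial.X_mem_supported]
    simp [orderLE]

/-- The determinant has order 1 and each total derivative raises the order by at most 1. Hence
truncation at order k loses nothing for lists of length at most k-1. -/
theorem hDeriv_mem_supported (L : List (Fin n)) :
    hDeriv L ∈ MvPolynomial.supported ℝ (orderLE n (L.length + 1)) := by
  induction L with
  | nil => exact hPoly_mem_supported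
  | cons i L ih => exact totalD_mem_supported i ih

open Classical in
/-- The polynomial on the jet space obtained by dropping the derivatives of order above `k`. -/
noncomputable def truncate (k : ℕ) :
    JetPoly n →ₐ[ℝ] MvPolynomial (Fin (n + 1) × MultiIdx n k) ℝ :=
  MvPolynomial.aeval fun p => if hp : ∑ i, p.2 i ≤ k then
    MvPolynomial.X (p.1, ⟨fun i => ⟨p.2 i, Nat.lt_succ_of_le
      ((Finset.single_le_sum (fun _ _ => Nat.zero_le _) (Finset.mem_univ i)).trans hp)⟩, hp⟩)
    else 0

theorem polyFun_truncate {k : ℕ} {P : JetPoly n}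
    (hP : P ∈ MvPolynomial.supported ℝ (orderLE n k)) (g : Fin (n + 1) → Rn n → ℝ) (x : Rn n) :
    polyFun (truncate k P) (jet k g x) = MvPolynomial.eval (jetVal g x) P := by
  rw [MvPolynomial.supported_eq_adjoin_X] at hP
  induction hP using Algebra.adjoin_induction with
  | mem P hP =>
    obtain ⟨p, hp, rfl⟩ := hP
    have hp' : ∑ i, p.2 i ≤ k := hp
    simp [truncate, polyFun, jetVal, hp', jet]
  | algebraMap r => simp [polyFun]
  | add P Q _ _ hP hQ => simp only [polyFun, map_add] at *; rw [hP, hQ]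
  | mul P Q _ _ hP hQ => simp only [polyFun, map_mul] at *; rw [hP, hQ]

/-- The ideal of polynomials on the jet space that defines the bad set. -/
noncomputable def badIdeal (n k : ℕ) : Ideal (MvPolynomial (Fin (n + 1) × MultiIdx n k) ℝ) :=
  Ideal.span {q | ∃ L : List (Fin n), L.length ≤ k - 1 ∧ q = truncate k (hDeriv L)}

theorem jet_mem_zeroSet_badIdeal_iff {k : ℕ} (hk : 1 ≤ k) {g : Fin (n + 1) → Rn n → ℝ}
    (hg : ∀ l, ContDiff ℝ ∞ (g l)) (x : Rn n) :
    jet k g x ∈ zeroSet (badIdeal n k) ↔ x ∈ Z g (k - 1) := by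
  have key : ∀ L : List (Fin n), L.length ≤ k - 1 →
      polyFun (truncate k (hDeriv L)) (jet k g x) = listPd L (h g) x := by
    intro L hL
    have hsub : orderLE n (L.length + 1) ⊆ orderLE n k := fun p hp =>
      le_trans (show ∑ i, p.2 i ≤ L.length + 1 from hp) (by omega)
    have hmem := MvPolynomial.supported_mono (R := ℝ) hsub (hDeriv_mem_supported L)
    rw [polyFun_truncate hmem g x, listPd_h hg]
  rw [mem_Z_iff hg]
  constructor
  · intro hx L hL
    rw [← key L hL]
    exact hx _ (Ideal.subset_span ⟨L, hL, rfl⟩)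
  · intro hx
    have : badIdeal n k ≤ idealOf {jet k g x} := by
      refine Ideal.span_le.2 ?_
      rintro _ ⟨L, hL, rfl⟩ _ rfl
      rw [key L hL, hx L hL]
    exact fun p hp => this hp _ rfl

/-- Every point of the jet space is a jet at the origin, so the equations on jets of functions are
equations on the whole space. -/
theorem badSet_eq_zeroSet {k : ℕ} (hk : 1 ≤ k) : badSet n k = zeroSet (badIdeal n k) := by
  ext a
  constructor
  · rintro ⟨g, x, hg, rfl, hx⟩
    exact (jet_mem_zeroSet_badIdeal_iff hk hg x).2 hx
  · intro ha
    obtain ⟨g, hg, rfl⟩ := exists_jet_eq (0 : Rn n) a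
    exact ⟨g, 0, hg, rfl, (jet_mem_zeroSet_badIdeal_iff hk hg 0).1 ha⟩

end TotalDerivatives

/-! ### Dimension of solution sets of triangular systems -/

section Triangular

/-- A set on which the coordinates `e κ` are determined by a triangular system with parameters
in `P` has the expected dimension at most. -/
theorem dimH_le_of_triangular {ι κ P : Type*} [Fintype ι] [Fintype κ] [NormedAddCommGroup P]
    [NormedSpace ℝ P] [FiniteDimensional ℝ P] {e : κ → ι} (he : Function.Injective e)
    (ord : ι → ℕ) {rhs : κ → EuclideanSpace ℝ ι → P → ℝ}
    (hsm : ∀ j, ContDiff ℝ 1 (fun z : EuclideanSpace ℝ ι × P => rhs j z.1 z.2))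
    (htri : ∀ (j : κ) (a a' : EuclideanSpace ℝ ι) (π : P),
      (∀ i, (i ∉ range e ∨ ord i < ord (e j)) → a i = a' i) → rhs j a π = rhs j a' π)
    {S : Set (EuclideanSpace ℝ ι)} (hS : ∀ a ∈ S, ∃ π, ∀ j, a (e j) = rhs j a π) :
    dimH S ≤ ((Fintype.card ι - Fintype.card κ + finrank ℝ P : ℕ) : ENNReal) := by
  classical
  -- Repeated substitution: starting from the free coordinates, the m-th iterate is correct on all
  -- coordinates of order below m. After finitely many rounds S lies in the image of a C¹ map from
  -- the free coordinates and parameters.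
  let Φ : ℕ → (({i : ι // i ∉ range e} → ℝ) × P) → EuclideanSpace ℝ ι := fun m => Nat.rec
    (fun b => WithLp.toLp 2 fun i => if hi : i ∉ range e then b.1 ⟨i, hi⟩ else 0)
    (fun _ φ b => WithLp.toLp 2 fun i => if hi : ∃ j, e j = i then rhs hi.choose (φ b) b.2
      else b.1 ⟨i, hi⟩) m
  have hΦ0 : ∀ b i, Φ 0 b i = if hi : i ∉ range e then b.1 ⟨i, hi⟩ else 0 := fun b i => rfl
  have hΦs : ∀ m b i, Φ (m + 1) b i = if hi : ∃ j, e j = i then rhs hi.choose (Φ m b) b.2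
      else b.1 ⟨i, hi⟩ := fun m b i => rfl
  have hΦc : ∀ m, ContDiff ℝ 1 (Φ m) := by
    intro m
    induction m with
    | zero =>
      rw [contDiff_euclidean]
      intro i
      simp only [hΦ0]
      split_ifs <;> fun_prop
    | succ m ih =>
      rw [contDiff_euclidean]
      intro i
      simp only [hΦs]
      split_ifs with hi
      · exact (hsm hi.choose).comp (ih.prodMk contDiff_snd)
      · fun_prop
  have hsub : S ⊆ range (Φ ((Finset.univ.sup ord) + 1)) := by
    intro a ha
    obtain ⟨π, hπ⟩ := hS a ha
    let b : ({i : ι // i ∉ range e} → ℝ) × P := (fun i => a i, π)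
    have key : ∀ m i, (i ∉ range e ∨ ord i < m) → Φ m b i = a i := by
      intro m
      induction m with
      | zero =>
        intro i hi
        have hi : i ∉ range e := hi.resolve_right (by simp)
        rw [hΦ0, dif_pos hi]
      | succ m ih =>
        intro i hi
        rw [hΦs]
        split_ifs with hex
        · have hlt : ord i < m + 1 := hi.resolve_left fun h => h hex
          have hej := hex.choose_spec
          rw [← congrArg (fun i => a i) hej]
          simp only
          rw [hπ]
          refine htri _ _ _ _ fun i' hi' => ih i' ?_
          rw [hej] at hi'
          exact hi'.imp_right fun h => by omega
        · rfl
    refine ⟨b, ?_⟩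
    ext i
    exact key _ i (Or.inr (Nat.lt_succ_of_le (Finset.le_sup (Finset.mem_univ i))))
  have hrange := (hΦc (Finset.univ.sup ord + 1)).dimH_range_le
  refine (dimH_mono hsub).trans (hrange.trans ?_)
  have hcard : Fintype.card {i : ι // i ∉ range e} = Fintype.card ι - Fintype.card κ := by
    rw [Fintype.card_subtype_compl]
    congr 1
    exact (Fintype.card_congr (Equiv.ofInjective e he)).symm
  rw [finrank_prod, finrank_fintype_fun_eq_card, hcard]

end Triangular

/-! ### Degenerating a determinant of given corank -/

section Determinants

/-- The columns in `Q` of `B`, reduced by combinations of the other columns. -/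
def redCol {n : ℕ} (Q : Finset (Fin (n + 1))) (X : ↥Qᶜ × ↥Q → ℝ)
    (B : Matrix (Fin (n + 1)) (Fin (n + 1)) ℝ) (l : Fin (n + 1)) (c : ↥Q) : ℝ :=
  B l c - ∑ d : ↥Qᶜ, B l d * X (d, c)

/-- The matrix with the columns of `A` outside `Q` and the reduced columns of `B` in `Q`. -/
def glue {n : ℕ} (Q : Finset (Fin (n + 1))) (X : ↥Qᶜ × ↥Q → ℝ)
    (A B : Matrix (Fin (n + 1)) (Fin (n + 1)) ℝ) : Matrix (Fin (n + 1)) (Fin (n + 1)) ℝ :=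
  Matrix.of fun l c => if hc : c ∈ Q then redCol Q X B l ⟨c, hc⟩ else A l c

variable {n : ℕ} (Q : Finset (Fin (n + 1))) (X : ↥Qᶜ × ↥Q → ℝ)

/-- The reduction is a column operation, hence right multiplication by a matrix independent of A.
The value of det W plays no role later. -/
theorem exists_glue_eq_mul : ∃ W : Matrix (Fin (n + 1)) (Fin (n + 1)) ℝ,
    ∀ A : Matrix (Fin (n + 1)) (Fin (n + 1)) ℝ, A * W = glue Q X A A := by
  refine ⟨Matrix.of fun d c => (if d = c then 1 else 0) -
    (if hc : c ∈ Q then if hd : d ∈ Qᶜ then X (⟨d, hd⟩, ⟨c, hc⟩) else 0 else 0), fun A => ?_⟩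
  ext l c
  simp only [Matrix.mul_apply, Matrix.of_apply, mul_sub, Finset.sum_sub_distrib, glue, redCol]
  by_cases hc : c ∈ Q
  · simp only [hc, dif_pos]
    congr 1
    · simp
    · rw [← Finset.sum_subset (Finset.subset_univ Qᶜ)
        fun d _ hd => by rw [dif_neg hd, mul_zero], ← Finset.sum_coe_sort]
      exact Finset.sum_congr rfl fun d _ => by rw [dif_pos d.2]
  · simp [hc]

/-- The reduced columns in Q vanish at t = 0, so t can be divided out of each of them. The resulting
determinant is det A(t) · det W / t^|Q|, which tends to 0, while its matrix tends to the glued one.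
-/
theorem det_glue_eq_zero {A : ℝ → Matrix (Fin (n + 1)) (Fin (n + 1)) ℝ}
    {B : Matrix (Fin (n + 1)) (Fin (n + 1)) ℝ}
    (hA : ∀ l c, HasDerivAt (fun t => A t l c) (B l c) 0)
    (hred : ∀ l c, redCol Q X (A 0) l c = 0)
    (hdet : (fun t => (A t).det) =o[𝓝 0] fun t : ℝ => t ^ Q.card) :
    (glue Q X (A 0) B).det = 0 := by
  obtain ⟨W, hW⟩ := exists_glue_eq_mul Q X
  have hlim : Filter.Tendsto (fun t : ℝ => glue Q X (A t) (t⁻¹ • A t)) (𝓝[≠] 0)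
      (𝓝 (glue Q X (A 0) B)) := by
    refine tendsto_pi_nhds.2 fun l => tendsto_pi_nhds.2 fun c => ?_
    by_cases hc : c ∈ Q
    · simp only [glue, Matrix.of_apply, hc, dif_pos]
      have hd : HasDerivAt (fun t => redCol Q X (A t) l ⟨c, hc⟩) (redCol Q X B l ⟨c, hc⟩) 0 :=
        (hA l c).sub (HasDerivAt.fun_sum fun d _ => (hA l d).mul_const _)
      have := hd.tendsto_slope_zero
      simp only [zero_add, hred, sub_zero] at this
      refine this.congr fun t => ?_
      simp only [redCol, Matrix.smul_apply, smul_eq_mul, mul_sub, Finset.mul_sum, mul_assoc]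
    · simp only [glue, Matrix.of_apply, hc, dif_neg, not_false_eq_true]
      exact (hA l c).continuousAt.tendsto.mono_left nhdsWithin_le_nhds
  have hdetlim : Filter.Tendsto (fun t : ℝ => (glue Q X (A t) (t⁻¹ • A t)).det) (𝓝[≠] 0)
      (𝓝 (glue Q X (A 0) B).det) :=
    ((continuous_id.matrix_det).tendsto _).comp hlim
  have hzero : Filter.Tendsto (fun t : ℝ => (glue Q X (A t) (t⁻¹ • A t)).det) (𝓝[≠] 0) (𝓝 0) := by
    have h1 := (hdet.mono (nhdsWithin_le_nhds (s := {0}ᶜ))).tendsto_div_nhds_zero.mul_const W.det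
    rw [zero_mul] at h1
    refine h1.congr' ?_
    filter_upwards [self_mem_nhdsWithin] with t ht
    have ht : t ≠ 0 := ht
    have hfac : A t * W = glue Q X (A t) (t⁻¹ • A t) *
        Matrix.diagonal (fun c => if c ∈ Q then t else 1) := by
      rw [hW]
      ext l c
      rw [Matrix.mul_diagonal]
      by_cases hc : c ∈ Q
      · simp only [glue, Matrix.of_apply, hc, dif_pos, if_pos, redCol, Matrix.smul_apply,
          smul_eq_mul, mul_assoc, ← Finset.mul_sum, ← mul_sub]
        field_simp
      · simp [glue, hc]
    have := congrArg Matrix.det hfac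
    rw [Matrix.det_mul, Matrix.det_mul, Matrix.det_diagonal, Finset.prod_ite] at this
    simp only [Finset.filter_univ_mem, Finset.prod_const, one_pow, mul_one] at this
    rw [div_mul_eq_mul_div, this]
    field_simp
  exact tendsto_nhds_unique hdetlim hzero

/-- A nonzero kernel vector must have a nonzero entry in Q, since otherwise it would be a relation
among the independent columns outside Q. Dividing by that entry solves for its column. -/
theorem exists_col_eq_of_det_glue_eq_zero {A B : Matrix (Fin (n + 1)) (Fin (n + 1)) ℝ}
    (hli : LinearIndepOn ℝ (fun c l => A l c) (Qᶜ : Finset (Fin (n + 1))))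
    (hdet : (glue Q X A B).det = 0) :
    ∃ c ∈ Q, ∃ y : Fin n → ℝ, ∀ l, glue Q X A B l c = ∑ t, y t * glue Q X A B l (c.succAbove t) := by
  obtain ⟨v, hv, hMv⟩ := Matrix.exists_mulVec_eq_zero_iff.2 hdet
  obtain ⟨c, hc, hvc⟩ : ∃ c ∈ Q, v c ≠ 0 := by
    by_contra! hcon
    apply hv
    have hsum : ∑ c ∈ Qᶜ, v c • (fun l => A l c) = 0 := by
      ext l
      have h1 := congrFun hMv l
      simp only [Matrix.mulVec, dotProduct] at h1
      rw [← Finset.sum_add_sum_compl Q, Finset.sum_eq_zero (s := Q), zero_add] at h1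
      · rw [Finset.sum_apply, ← h1]
        refine Finset.sum_congr rfl fun c hc => ?_
        simp [glue, Finset.mem_compl.1 hc, mul_comm]
      · intro c hc
        rw [hcon c hc, mul_zero]
    have := linearIndepOn_finset_iff.1 hli v hsum
    ext c
    by_cases hc : c ∈ Q
    · exact hcon c hc
    · exact this c (Finset.mem_compl.2 hc)
  refine ⟨c, hc, fun t => - v (c.succAbove t) / v c, fun l => ?_⟩
  have h1 := congrFun hMv l
  simp only [Matrix.mulVec, dotProduct, Pi.zero_apply] at h1
  rw [Fin.sum_univ_succAbove _ c] at h1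
  have h2 : ∑ t, -v (c.succAbove t) / v c * glue Q X A B l (c.succAbove t) =
      - (∑ t, glue Q X A B l (c.succAbove t) * v (c.succAbove t)) / v c := by
    rw [← Finset.sum_neg_distrib, Finset.sum_div]
    exact Finset.sum_congr rfl fun t _ => by ring
  rw [h2, eq_div_iff hvc]
  linarith

end Determinants

/-! ### Vanishing order along coordinate lines -/

section Vanishing

theorem isLittleO_pow_of_iterate_deriv {f : ℝ → ℝ} (hf : ContDiff ℝ ∞ f) {r : ℕ}
    (h0 : ∀ j ≤ r, deriv^[j] f 0 = 0) : f =o[𝓝 0] fun t => t ^ r := by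
  have h := taylor_isLittleO_univ (x₀ := 0) (n := r) (hf.of_le (by exact_mod_cast le_top))
  have hT : ∀ t, taylorWithinEval f r univ 0 t = 0 := by
    intro t
    rw [taylor_within_apply]
    refine Finset.sum_eq_zero fun j hj => ?_
    rw [iteratedDerivWithin_univ, iteratedDeriv_eq_iterate,
      h0 j (Nat.lt_succ_iff.1 (Finset.mem_range.1 hj)), smul_zero]
  simpa [hT] using h

variable {n : ℕ}

theorem hasDerivAt_line {f : Rn n → ℝ} (hf : ContDiff ℝ ∞ f) (x : Rn n) (i : Fin n) (t : ℝ) :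
    HasDerivAt (fun t : ℝ => f (x + t • EuclideanSpace.single i 1))
      (pd i f (x + t • EuclideanSpace.single i 1)) t := by
  have h1 : HasDerivAt (fun t : ℝ => x + t • (EuclideanSpace.single i (1 : ℝ) : Rn n))
      (EuclideanSpace.single i 1) t := by
    simpa using ((hasDerivAt_id t).smul_const (EuclideanSpace.single i (1 : ℝ) : Rn n)).const_add x
  exact ((hf.differentiable (by simp) _).hasFDerivAt).comp_hasDerivAt t h1

theorem iterate_deriv_line {f : Rn n → ℝ} (hf : ContDiff ℝ ∞ f) (x : Rn n) (i : Fin n) (j : ℕ) :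
    deriv^[j] (fun t : ℝ => f (x + t • EuclideanSpace.single i 1)) =
      fun t => listPd (List.replicate j i) f (x + t • EuclideanSpace.single i 1) := by
  induction j with
  | zero => rfl
  | succ j ih =>
    rw [Function.iterate_succ_apply', ih]
    ext t
    exact (hasDerivAt_line (contDiff_listPd _ hf) x i t).deriv

theorem h_isLittleO_line {g : Fin (n + 1) → Rn n → ℝ} (hg : ∀ l, ContDiff ℝ ∞ (g l)) {m r : ℕ}
    (hr : r ≤ m) {x : Rn n} (hx : x ∈ Z g m) (i : Fin n) :
    (fun t : ℝ => h g (x + t • EuclideanSpace.single i 1)) =o[𝓝 0] fun t => t ^ r := by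
  have hc : ContDiff ℝ ∞ (fun t : ℝ => h g (x + t • EuclideanSpace.single i 1)) :=
    (contDiff_h hg).comp (by fun_prop)
  refine isLittleO_pow_of_iterate_deriv hc fun j hj => ?_
  rw [iterate_deriv_line (contDiff_h hg)]
  simpa using (mem_Z_iff hg m x).1 hx (List.replicate j i) (by simp; omega)

end Vanishing

/-! ### Codimension of the strata -/

section Strata

variable {n k : ℕ}

/-- The exponent of the derivative that appears in column `c` of the matrix `(∇g, g)`. -/
def colVec (c : Fin (n + 1)) : Fin n → ℕ := fun j => if j.castSucc = c then 1 else 0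

theorem colVec_castSucc (j : Fin n) : colVec j.castSucc = Pi.single j 1 := by
  ext i
  simp [colVec, Pi.single_apply, eq_comm]

theorem colVec_last : colVec (Fin.last n) = 0 := by
  ext i
  simp [colVec, Fin.castSucc_ne_last]

theorem gradMatrix_apply {g : Fin (n + 1) → Rn n → ℝ} (hg : ∀ l, ContDiff ℝ ∞ (g l)) (x : Rn n)
    (l c : Fin (n + 1)) : gradMatrix g x l c = mpd (colVec c) (g l) x := by
  refine Fin.lastCases ?_ (fun j => ?_) c
  · simp [gradMatrix, colVec_last, mpd_zero]
  · simp [gradMatrix, colVec_castSucc, mpd_single j (hg l)]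

theorem sum_colVec_le (c : Fin (n + 1)) : ∑ j, colVec c j ≤ 1 := by
  refine Fin.lastCases ?_ (fun j => ?_) c
  · simp [colVec_last]
  · simp [colVec_castSucc]

/-- A multi-index given by natural numbers. -/
def multiIdx (β : Fin n → ℕ) (hβ : ∑ i, β i ≤ k) : MultiIdx n k :=
  ⟨fun i => ⟨β i, Nat.lt_succ_of_le
    ((Finset.single_le_sum (fun _ _ => Nat.zero_le _) (Finset.mem_univ i)).trans hβ)⟩, hβ⟩

theorem multiIdx_inj {β γ : Fin n → ℕ} {hβ : ∑ i, β i ≤ k} {hγ : ∑ i, γ i ≤ k} :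
    multiIdx β hβ = multiIdx γ hγ ↔ β = γ := by
  refine ⟨fun h => funext fun i => ?_, fun h => by subst h; rfl⟩
  exact congrArg (fun b : MultiIdx n k => (b.1 i : ℕ)) h

/-- The jet coordinate of the entries of column `c`. -/
def colIdx (hk : 2 ≤ k) (c : Fin (n + 1)) : MultiIdx n k :=
  multiIdx (colVec c) ((sum_colVec_le c).trans (by omega))

/-- The jet coordinate of the derivatives in direction `i` of the entries of column `c`. -/
def derivColIdx (hk : 2 ≤ k) (i : Fin n) (c : Fin (n + 1)) : MultiIdx n k :=
  multiIdx (colVec c + Pi.single i 1) (by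
    have := sum_colVec_le c
    simp only [Pi.add_apply, Finset.sum_add_distrib, Finset.sum_pi_single', Finset.mem_univ,
      if_true]
    omega)

/-- The matrix `(∇g, g)` as a function of the jet. -/
def jetMatrix (hk : 2 ≤ k) (a : JetSpace n k) : Matrix (Fin (n + 1)) (Fin (n + 1)) ℝ :=
  Matrix.of fun l c => a (l, colIdx hk c)

/-- The derivative in direction `i` of the matrix `(∇g, g)` as a function of the jet. -/
def jetDerivMatrix (hk : 2 ≤ k) (i : Fin n) (a : JetSpace n k) :
    Matrix (Fin (n + 1)) (Fin (n + 1)) ℝ :=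
  Matrix.of fun l c => a (l, derivColIdx hk i c)

/-- The jets for which the columns in `Q` depend on the others and, for `i ∈ I`, the column `q i`
of the glued matrix depends on the others. -/
def stratum (hk : 2 ≤ k) (Q : Finset (Fin (n + 1))) (I : Finset (Fin n))
    (q : Fin n → Fin (n + 1)) : Set (JetSpace n k) :=
  {a | ∃ (X : ↥Qᶜ × ↥Q → ℝ) (y : ↥I × Fin n → ℝ),
    (∀ l c, redCol Q X (jetMatrix hk a) l c = 0) ∧
    ∀ (i : ↥I) l, glue Q X (jetMatrix hk a) (jetDerivMatrix hk i a) l (q i) =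
      ∑ t, y (i, t) * glue Q X (jetMatrix hk a) (jetDerivMatrix hk i a) l ((q i).succAbove t)}

/-- The combinatorial conditions that give the stratum codimension at least `n + 1`. -/
structure Admissible (Q : Finset (Fin (n + 1))) (I : Finset (Fin n)) (q : Fin n → Fin (n + 1)) :
    Prop where
  last_notMem : Fin.last n ∉ Q
  mem : ∀ i, q i ∈ Q
  eq_of_mem : ∀ i ∈ I, i.castSucc ∈ Q → ∀ c ∈ Q, c = i.castSucc
  le_card : n + 1 ≤ Q.card ^ 2 + I.card

theorem single_add_single_eq {a b c d : Fin n}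
    (h : (Pi.single a 1 + Pi.single b 1 : Fin n → ℕ) = Pi.single c 1 + Pi.single d 1) :
    (a = c ∧ b = d) ∨ (a = d ∧ b = c) := by
  have key : ∀ {u v : Fin n}, (Pi.single u 1 : Fin n → ℕ) = Pi.single v 1 → u = v := by
    intro u v huv
    by_contra hne
    have := congrFun huv u
    simp [hne] at this
  by_cases hac : a = c
  · subst hac
    exact Or.inl ⟨rfl, key (add_left_cancel h)⟩
  · by_cases had : a = d
    · subst had
      rw [add_comm (Pi.single c 1)] at h
      exact Or.inr ⟨rfl, key (add_left_cancel h)⟩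
    · have := congrFun h a
      simp [Pi.single_apply, hac, had] at this

/-- This keeps the coordinates solved for apart in spite of ∂_i∂_j = ∂_j∂_i. If the two indices are
swapped, then i itself is a column in Q, and admissibility leaves Q no other column, so the swap is
trivial. -/
theorem Admissible.eq_of_colVec_add {Q : Finset (Fin (n + 1))} {I : Finset (Fin n)}
    {q : Fin n → Fin (n + 1)} (hA : Admissible Q I q) {i i' : Fin n} (hi : i ∈ I)
    {c : Fin (n + 1)} (hc : c ∈ Q)
    (h : colVec (q i') + Pi.single i' 1 = colVec c + Pi.single i 1) : i' = i ∧ c = q i := by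
  obtain ⟨j, rfl⟩ := Fin.exists_castSucc_eq.2 (fun h => hA.last_notMem (h ▸ hc) : c ≠ Fin.last n)
  obtain ⟨j', hj'⟩ := Fin.exists_castSucc_eq.2
    (fun h => hA.last_notMem (h ▸ hA.mem i') : q i' ≠ Fin.last n)
  rw [← hj', colVec_castSucc, colVec_castSucc] at h
  rcases single_add_single_eq h with ⟨h1, h2⟩ | ⟨h1, h2⟩
  · subst h1 h2
    exact ⟨rfl, hj'⟩
  · subst h1 h2
    have hmem : j'.castSucc ∈ Q := hj' ▸ hA.mem i'
    have h3 := hA.eq_of_mem _ hi hmem _ hc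
    exact ⟨Fin.castSucc_injective _ h3, h3.trans (hA.eq_of_mem _ hi hmem _ (hA.mem _)).symm⟩

/-- The weight that orders the jet coordinates on a stratum. -/
def weight (Q : Finset (Fin (n + 1))) (β : Fin n → ℕ) : ℕ :=
  ∑ j, β j * (1 + if j.castSucc ∈ Q then 1 else 0)

theorem weight_add_single (Q : Finset (Fin (n + 1))) (β : Fin n → ℕ) (i : Fin n) :
    weight Q (β + Pi.single i 1) = weight Q β + (1 + if i.castSucc ∈ Q then 1 else 0) := by
  simp [weight, add_mul, Finset.sum_add_distrib, Pi.single_apply]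

theorem weight_colVec_of_mem {Q : Finset (Fin (n + 1))} (hQ : Fin.last n ∉ Q) {c : Fin (n + 1)}
    (hc : c ∈ Q) : weight Q (colVec c) = 2 := by
  obtain ⟨j, rfl⟩ := Fin.exists_castSucc_eq.2 (fun h => hQ (h ▸ hc) : c ≠ Fin.last n)
  simp [weight, colVec_castSucc, Pi.single_apply, hc]

theorem weight_colVec_of_notMem {Q : Finset (Fin (n + 1))} {c : Fin (n + 1)} (hc : c ∉ Q) :
    weight Q (colVec c) ≤ 1 := by
  induction c using Fin.lastCases with
  | last => simp [weight, colVec_last]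
  | cast j => simp [weight, colVec_castSucc, Pi.single_apply, hc]

/-- There are (n+1)(r+s) equations against (n+1-r)r parameters X and sn parameters y; the balance is
r² + s. -/
theorem stratum_dim_count {n r s N : ℕ} (hr : r ≤ n + 1) (hle : n + 1 ≤ r ^ 2 + s)
    (hN : (n + 1) * (r + s) ≤ N) :
    N - (n + 1) * (r + s) + ((n + 1 - r) * r + s * n) ≤ N - (n + 1) := by
  obtain ⟨u, hu⟩ := Nat.exists_eq_add_of_le hr
  have hid : (n + 1) * (r + s) = (n + 1 - r) * r + s * n + (r ^ 2 + s) := by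
    have h1 : n + 1 - r = u := by omega
    rw [h1, mul_add]
    nth_rewrite 1 [hu]
    ring
  omega

theorem dimH_stratum_le (hk : 2 ≤ k) {Q : Finset (Fin (n + 1))} {I : Finset (Fin n)}
    {q : Fin n → Fin (n + 1)} (hA : Admissible Q I q) :
    dimH (stratum hk Q I q) ≤
      ((Fintype.card (Fin (n + 1) × MultiIdx n k) - (n + 1) : ℕ) : ENNReal) := by
  -- The coordinates solved for: the entries of the columns in Q, and for i ∈ I the ∂_i-derivatives
  -- of the entries of column q i.
  let e : Fin (n + 1) × (↥Q ⊕ ↥I) → Fin (n + 1) × MultiIdx n k := fun s =>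
    (s.1, Sum.elim (fun c : ↥Q => colIdx hk c) (fun i : ↥I => derivColIdx hk i (q i)) s.2)
  have hsum : ∀ (c : Fin (n + 1)) (i : Fin n), ∀ c' ∈ Q,
      colVec c ≠ colVec c' + Pi.single i 1 := by
    intro c i c' hc' h
    have h1 := sum_colVec_le c
    obtain ⟨j, rfl⟩ :=
      Fin.exists_castSucc_eq.2 (fun h => hA.last_notMem (h ▸ hc') : c' ≠ Fin.last n)
    rw [h, colVec_castSucc] at h1
    simp [Finset.sum_add_distrib] at h1
  have hcol : ∀ {c c' : Fin (n + 1)}, c ∈ Q → colVec c = colVec c' → c = c' := by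
    intro c c' hc h
    obtain ⟨j, rfl⟩ :=
      Fin.exists_castSucc_eq.2 (fun h => hA.last_notMem (h ▸ hc) : c ≠ Fin.last n)
    have := congrFun h j
    by_contra hne
    simp [colVec, hne] at this
  have he : Function.Injective e := by
    rintro ⟨l, c | i⟩ ⟨l', c' | i'⟩ h <;>
      simp only [e, Prod.mk.injEq, Sum.elim_inl, Sum.elim_inr, colIdx, derivColIdx,
        multiIdx_inj] at h
    · rw [h.1, Subtype.ext (hcol c.2 h.2)]
    · exact absurd h.2 (hsum _ _ _ (hA.mem _))
    · exact absurd h.2.symm (hsum _ _ _ (hA.mem _))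
    · rw [h.1, Subtype.ext (hA.eq_of_colVec_add i'.2 (hA.mem _) h.2).1]
  let rhs : Fin (n + 1) × (↥Q ⊕ ↥I) → JetSpace n k →
      ((↥Qᶜ × ↥Q → ℝ) × (↥I × Fin n → ℝ)) → ℝ := fun s a π =>
    Sum.elim (fun c : ↥Q => ∑ d : ↥Qᶜ, jetMatrix hk a s.1 d * π.1 (d, c))
      (fun i : ↥I => ∑ d : ↥Qᶜ, jetDerivMatrix hk i a s.1 d * π.1 (d, ⟨q i, hA.mem i⟩) +
        ∑ t, π.2 (i, t) * glue Q π.1 (jetMatrix hk a) (jetDerivMatrix hk i a) s.1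
          ((q i).succAbove t)) s.2
  have hsm : ∀ s, ContDiff ℝ 1 (fun z : JetSpace n k × ((↥Qᶜ × ↥Q → ℝ) × (↥I × Fin n → ℝ)) =>
      rhs s z.1 z.2) := by
    rintro ⟨l, c | i⟩
    · simp only [rhs, Sum.elim_inl, jetMatrix, Matrix.of_apply]
      fun_prop
    · simp only [rhs, Sum.elim_inr]
      refine ContDiff.add ?_ (ContDiff.sum fun t _ => ContDiff.mul (by fun_prop) ?_)
      · simp only [jetDerivMatrix, Matrix.of_apply]
        fun_prop
      · simp only [glue, redCol, jetMatrix, jetDerivMatrix, Matrix.of_apply]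
        split_ifs <;> fun_prop
  -- Columns in Q have weight 2 and the others at most 1, and ∂_i adds the same amount to each. So
  -- the right-hand sides involve lower weights only, except for the ∂_i-derivatives of columns in Q
  -- other than q i, which are free coordinates.
  have htri : ∀ s (a a' : JetSpace n k) π, (∀ p, (p ∉ range e ∨
      weight Q (fun j => (p.2.1 j : ℕ)) < weight Q (fun j => ((e s).2.1 j : ℕ))) → a p = a' p) →
      rhs s a π = rhs s a' π := by
    rintro ⟨l, c | i⟩ a a' π h
    · have hw : weight Q (fun j => ((e (l, Sum.inl c)).2.1 j : ℕ)) = 2 :=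
        weight_colVec_of_mem hA.last_notMem c.2
      have h1 : ∀ d : ↥Qᶜ, jetMatrix hk a l d = jetMatrix hk a' l d := by
        intro d
        refine h _ (Or.inr ?_)
        rw [hw]
        exact Nat.lt_succ_of_le (weight_colVec_of_notMem (Finset.mem_compl.1 d.2))
      simp only [rhs, Sum.elim_inl, h1]
    · have hw : weight Q (fun j => ((e (l, Sum.inr i)).2.1 j : ℕ)) =
          2 + (1 + if (i : Fin n).castSucc ∈ Q then 1 else 0) := by
        refine (weight_add_single Q (colVec (q i)) i).trans ?_
        rw [weight_colVec_of_mem hA.last_notMem (hA.mem i)]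
      have h1 : ∀ d ∉ Q, jetMatrix hk a l d = jetMatrix hk a' l d := by
        intro d hd
        refine h _ (Or.inr ?_)
        rw [hw]
        exact lt_of_le_of_lt (weight_colVec_of_notMem hd) (by omega)
      have h2 : ∀ d ∉ Q, jetDerivMatrix hk i a l d = jetDerivMatrix hk i a' l d := by
        intro d hd
        refine h _ (Or.inr ?_)
        rw [hw]
        refine (weight_add_single Q (colVec d) i).trans_lt ?_
        have := weight_colVec_of_notMem hd
        omega
      have h3 : ∀ c ∈ Q, c ≠ q i → jetDerivMatrix hk i a l c = jetDerivMatrix hk i a' l c := by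
        intro c hc hne
        refine h _ (Or.inl ?_)
        rintro ⟨⟨l', c' | i'⟩, h'⟩ <;>
          simp only [e, Prod.mk.injEq, Sum.elim_inl, Sum.elim_inr, colIdx, derivColIdx,
            multiIdx_inj] at h'
        · exact hsum _ _ _ hc h'.2
        · exact hne (hA.eq_of_colVec_add i.2 hc h'.2).2
      have h4 : ∀ d : ↥Qᶜ, jetDerivMatrix hk i a l d = jetDerivMatrix hk i a' l d :=
        fun d => h2 d (Finset.mem_compl.1 d.2)
      simp only [rhs, Sum.elim_inr, h4]
      congr 1
      refine Finset.sum_congr rfl fun t _ => ?_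
      congr 1
      simp only [glue, Matrix.of_apply, redCol, h4]
      split_ifs with ht
      · rw [h3 _ ht (Fin.succAbove_ne _ _)]
      · exact h1 _ ht
  have hS : ∀ a ∈ stratum hk Q I q, ∃ π, ∀ s, a (e s) = rhs s a π := by
    rintro a ⟨X, y, hX, hy⟩
    refine ⟨(X, y), ?_⟩
    rintro ⟨l, c | i⟩
    · exact sub_eq_zero.1 (hX l c)
    · have h1 := hy i l
      have h2 : glue Q X (jetMatrix hk a) (jetDerivMatrix hk i a) l (q i) =
          jetDerivMatrix hk i a l (q i) -
            ∑ d : ↥Qᶜ, jetDerivMatrix hk i a l d * X (d, ⟨q i, hA.mem i⟩) := by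
        simp only [glue, Matrix.of_apply, hA.mem, dif_pos, redCol]
      have h3 := h2.symm.trans h1
      rw [sub_eq_iff_eq_add'] at h3
      exact h3
  refine (dimH_le_of_triangular he (fun p => weight Q fun j => (p.2.1 j : ℕ)) hsm htri hS).trans ?_
  have hcard := Fintype.card_le_of_injective e he
  have hQn : Q.card ≤ n + 1 := by simpa using Finset.card_le_univ Q
  have h1 : Fintype.card (Fin (n + 1) × (↥Q ⊕ ↥I)) = (n + 1) * (Q.card + I.card) := by simp
  have h2 : finrank ℝ ((↥Qᶜ × ↥Q → ℝ) × (↥I × Fin n → ℝ)) =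
      (n + 1 - Q.card) * Q.card + I.card * n := by
    rw [finrank_prod, finrank_fintype_fun_eq_card, finrank_fintype_fun_eq_card]
    simp
  rw [h1] at hcard
  rw [h1, h2]
  exact Nat.cast_le.2 (stratum_dim_count hQn hA.le_card hcard)

end Strata

/-! ### Dimension of the bad set -/

section BadSetDimension

variable {n k : ℕ}

theorem jetMatrix_jet (hk : 2 ≤ k) {g : Fin (n + 1) → Rn n → ℝ} (hg : ∀ l, ContDiff ℝ ∞ (g l))
    (x : Rn n) : jetMatrix hk (jet k g x) = gradMatrix g x := by
  ext l c
  rw [gradMatrix_apply hg]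
  rfl

theorem hasDerivAt_gradMatrix_line (hk : 2 ≤ k) {g : Fin (n + 1) → Rn n → ℝ}
    (hg : ∀ l, ContDiff ℝ ∞ (g l)) (x : Rn n) (i : Fin n) (l c : Fin (n + 1)) :
    HasDerivAt (fun t : ℝ => gradMatrix g (x + t • EuclideanSpace.single i 1) l c)
      (jetDerivMatrix hk i (jet k g x) l c) 0 := by
  simp only [gradMatrix_apply hg]
  have h1 := hasDerivAt_line (contDiff_mpd (colVec c) (hg l)) x i 0
  rw [pd_mpd i _ (hg l), zero_smul, add_zero] at h1
  exact h1

/-- A nonzero value of g lets the last column belong to a basis of the column space, so that Q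
contains only gradient columns. The corank |Q| then decides whether the derivative conditions are
needed. -/
theorem exists_stratum (hk : 2 ≤ k) (hkn : n + 1 ≤ k ^ 2) {g : Fin (n + 1) → Rn n → ℝ}
    (hg : ∀ l, ContDiff ℝ ∞ (g l)) {x : Rn n} (hx : x ∈ Z g (k - 1)) {l₀ : Fin (n + 1)}
    (hl₀ : g l₀ x ≠ 0) :
    ∃ Q I q, Admissible Q I q ∧ jet k g x ∈ stratum hk Q I q := by
  classical
  set A := gradMatrix g x with hAdef
  have hdet : A.det = 0 := (mem_Z_iff hg _ x).1 hx [] (by simp)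
  let v : Fin (n + 1) → Fin (n + 1) → ℝ := fun c l => A l c
  have hlast : v (Fin.last n) ≠ 0 := by
    intro h0
    have := congrFun h0 l₀
    simp only [v, hAdef, gradMatrix_apply hg, colVec_last, mpd_zero] at this
    exact hl₀ this
  obtain ⟨b, -, hsb, hspan, hli⟩ := exists_linearIndepOn_extension
    (linearIndepOn_singleton_iff (R := ℝ).2 hlast) (subset_univ _)
  let Q : Finset (Fin (n + 1)) := Finset.univ.filter (· ∉ b)
  have hQb : ((Qᶜ : Finset (Fin (n + 1))) : Set (Fin (n + 1))) = b := by
    ext c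
    simp [Q]
  have hlastQ : Fin.last n ∉ Q := by
    have : Fin.last n ∈ b := hsb rfl
    simp [Q, this]
  rw [← hQb] at hli hspan
  have hcomb : ∀ c : Fin (n + 1), ∃ f : ↥Qᶜ → ℝ, ∑ d, f d • v d = v c := fun c =>
    (Submodule.mem_span_image_finset_iff_exists_fun ℝ).1 (hspan ⟨c, mem_univ c, rfl⟩)
  choose f hf using hcomb
  let X : ↥Qᶜ × ↥Q → ℝ := fun p => f p.2 p.1
  have hred : ∀ l c, redCol Q X A l c = 0 := by
    intro l c
    have := congrFun (hf c) l
    simp only [Finset.sum_apply, Pi.smul_apply, smul_eq_mul, v] at this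
    rw [redCol, ← this, sub_eq_zero]
    exact Finset.sum_congr rfl fun d _ => mul_comm _ _
  have hQne : Q.Nonempty := by
    by_contra hemp
    rw [Finset.not_nonempty_iff_eq_empty] at hemp
    have hglue : glue Q X A A = A := by
      ext l c
      have hc : c ∉ Q := by simp [hemp]
      simp [glue, hc]
    obtain ⟨c, hc, -⟩ := exists_col_eq_of_det_glue_eq_zero Q X (A := A) (B := A) hli
      (by rw [hglue, hdet])
    simp [hemp] at hc
  have hjA : jetMatrix hk (jet k g x) = A := jetMatrix_jet hk hg x
  rcases le_or_gt k Q.card with hcase | hcase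
  · obtain ⟨c, hc⟩ := hQne
    -- Corank at least k: the rank condition alone has codimension at least k² ≥ n+1.
    refine ⟨Q, ∅, fun _ => c, ⟨hlastQ, fun _ => hc, by simp, ?_⟩, X, 0, ?_, ?_⟩
    · exact hkn.trans ((Nat.pow_le_pow_left hcase 2).trans (by simp))
    · rw [hjA]; exact hred
    · rintro ⟨i, hi⟩
      simp at hi
  · have hcol : ∀ i : Fin n, ∃ c ∈ Q, ∃ y : Fin n → ℝ, ∀ l,
        glue Q X A (jetDerivMatrix hk i (jet k g x)) l c =
          ∑ t, y t * glue Q X A (jetDerivMatrix hk i (jet k g x)) l (c.succAbove t) := by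
      intro i
      have hA0 : gradMatrix g (x + (0 : ℝ) • EuclideanSpace.single i 1) = A := by simp [hAdef]
      have hz := det_glue_eq_zero Q X
        (A := fun t => gradMatrix g (x + t • EuclideanSpace.single i 1))
        (hasDerivAt_gradMatrix_line hk hg x i) (by rw [hA0]; exact hred)
        (h_isLittleO_line hg (by omega) hx i)
      rw [hA0] at hz
      exact exists_col_eq_of_det_glue_eq_zero Q X hli hz
    choose q hq y hy using hcol
    have hmem : ∀ I : Finset (Fin n), jet k g x ∈ stratum hk Q I q := by
      intro I
      refine ⟨X, fun p => y p.1 p.2, ?_, ?_⟩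
      · rw [hjA]; exact hred
      · intro i l
        rw [hjA]
        exact hy i l
    have hQ1 : 1 ≤ Q.card := hQne.card_pos
    rcases hQ1.eq_or_lt with h1 | h2
    -- Corank 1: all n directions are needed, 1 + n being exactly the required number, and they are
    -- allowed because Q is a singleton.
    · refine ⟨Q, Finset.univ, q, ⟨hlastQ, hq, ?_, ?_⟩, hmem _⟩
      · intro i _ hi c hc
        exact Finset.card_le_one.1 h1.symm.le _ hc _ hi
      · simp [← h1, add_comm]
    -- Corank r ≥ 2: omitting the directions in Q costs at most r, and r² + (n - r) ≥ n + 1.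
    · refine ⟨Q, Finset.univ.filter (fun i => i.castSucc ∉ Q), q, ⟨hlastQ, hq, ?_, ?_⟩, hmem _⟩
      · intro i hi hi'
        exact absurd hi' (Finset.mem_filter.1 hi).2
      · have hle : (Finset.univ.filter (fun i : Fin n => i.castSucc ∈ Q)).card ≤ Q.card :=
          Finset.card_le_card_of_injOn Fin.castSucc (fun i hi => by simpa using hi)
            (Fin.castSucc_injective n).injOn
        have hsum := Finset.card_filter_add_card_filter_not (s := (Finset.univ : Finset (Fin n)))
          (fun i => i.castSucc ∈ Q)
        rw [Finset.card_univ, Fintype.card_fin] at hsum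
        nlinarith

theorem dimH_jets_of_zeros_le (hk : 2 ≤ k) :
    dimH {a : JetSpace n k | ∀ l, a (l, colIdx hk (Fin.last n)) = 0} ≤
      ((Fintype.card (Fin (n + 1) × MultiIdx n k) - (n + 1) : ℕ) : ENNReal) := by
  have h := dimH_le_of_triangular (P := Fin 0 → ℝ)
    (e := fun l : Fin (n + 1) => (l, (colIdx hk (Fin.last n) : MultiIdx n k)))
    (fun l l' h => (Prod.mk.injEq _ _ _ _ ▸ h).1) (fun _ => 0) (rhs := fun _ _ _ => 0)
    (fun _ => contDiff_const) (fun _ _ _ _ _ => rfl)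
    (S := {a : JetSpace n k | ∀ l, a (l, colIdx hk (Fin.last n)) = 0}) fun a ha => ⟨0, ha⟩
  simpa using h

theorem dimH_badSet_le (hk : 2 ≤ k) (hkn : n + 1 ≤ k ^ 2) :
    dimH (badSet n k) ≤
      ((Fintype.card (Fin (n + 1) × MultiIdx n k) - (n + 1) : ℕ) : ENNReal) := by
  have hsub : badSet n k ⊆ {a : JetSpace n k | ∀ l, a (l, colIdx hk (Fin.last n)) = 0} ∪
      ⋃ (s : Finset (Fin (n + 1)) × Finset (Fin n) × (Fin n → Fin (n + 1)))
        (_ : Admissible s.1 s.2.1 s.2.2), stratum hk s.1 s.2.1 s.2.2 := by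
    rintro _ ⟨g, x, hg, rfl, hx⟩
    by_cases hzero : ∀ l, g l x = 0
    · left
      intro l
      rw [← hzero l]
      change mpd (colVec (Fin.last n)) (g l) x = g l x
      rw [colVec_last, mpd_zero]
    · right
      push Not at hzero
      obtain ⟨l₀, hl₀⟩ := hzero
      obtain ⟨Q, I, q, hA, hmem⟩ := exists_stratum hk hkn hg hx hl₀
      exact mem_iUnion₂.2 ⟨(Q, I, q), hA, hmem⟩
  refine (dimH_mono hsub).trans ?_
  rw [dimH_union]
  refine max_le (dimH_jets_of_zeros_le hk) ?_
  rw [dimH_iUnion]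
  refine iSup_le fun s => ?_
  rw [dimH_iUnion]
  exact iSup_le fun hA => dimH_stratum_le hk hA

theorem succ_le_card_jetCoordinates (n k : ℕ) :
    n + 1 ≤ Fintype.card (Fin (n + 1) × MultiIdx n k) := by
  have hne : Nonempty (MultiIdx n k) := ⟨multiIdx 0 (by simp)⟩
  rw [Fintype.card_prod, Fintype.card_fin]
  exact Nat.le_mul_of_pos_right _ Fintype.card_pos

theorem isManifoldCollection_badSet (hk : 2 ≤ k) (hkn : n + 1 ≤ k ^ 2) :
    IsManifoldCollection (badSet n k) (n + 1) := by
  have hdim := dimH_badSet_le hk hkn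
  rw [badSet_eq_zeroSet (by omega)] at hdim ⊢
  exact isManifoldCollection_zeroSet (succ_le_card_jetCoordinates n k) _ hdim

end BadSetDimension

/-! ### Generic perturbations avoid the bad set -/

section Transversality

theorem IsSubmanifoldOfCodim.preimage {E F : Type*} [NormedAddCommGroup E] [NormedSpace ℝ E]
    [NormedAddCommGroup F] [NormedSpace ℝ F] {M : Set F} {c : ℕ} (hM : IsSubmanifoldOfCodim M c)
    {Θ : E → F} (hΘ : ContDiff ℝ ∞ Θ) (hs : ∀ p, Function.Surjective (fderiv ℝ Θ p)) :
    IsSubmanifoldOfCodim (Θ ⁻¹' M) c := by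
  intro p hp
  obtain ⟨U, φ, hU, hpU, hφ, hφs, hMU⟩ := hM (Θ p) hp
  refine ⟨Θ ⁻¹' U, φ ∘ Θ, hU.preimage hΘ.continuous, hpU,
    hφ.comp hΘ.contDiffOn fun _ h => h, fun x hx => ?_, ?_⟩
  · have hd : DifferentiableAt ℝ φ (Θ x) :=
      (hφ.contDiffAt (hU.mem_nhds hx)).differentiableAt (by simp)
    rw [fderiv_comp x hd (hΘ.differentiable (by simp) x)]
    exact (hφs _ hx).comp (hs x)
  · rw [← preimage_inter, hMU]
    rfl

variable {n k : ℕ}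

/-- The jet of the perturbed map, as a function of the point and the perturbation. -/
noncomputable def perturbedJet (k : ℕ) (g : Fin (n + 1) → Rn n → ℝ) (p : Rn n × JetSpace n k) :
    JetSpace n k :=
  jet k g p.1 + polyJet p.1 p.2

theorem contDiff_perturbedJet {g : Fin (n + 1) → Rn n → ℝ} (hg : ∀ l, ContDiff ℝ ∞ (g l)) :
    ContDiff ℝ ∞ (perturbedJet k g) := by
  rw [contDiff_euclidean]
  intro s
  have h1 : ContDiff ℝ ∞ (fun p : Rn n × JetSpace n k => mpd (fun i => (s.2.1 i : ℕ)) (g s.1) p.1) :=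
    (contDiff_mpd _ (hg s.1)).comp contDiff_fst
  refine h1.add (ContDiff.sum fun β _ => ContDiff.mul (by fun_prop) ?_)
  exact (contDiff_monoDeriv _ _).comp contDiff_fst

/-- For fixed x the map is affine in α with linear part `polyJet x`, which is already onto. -/
theorem surjective_fderiv_perturbedJet {g : Fin (n + 1) → Rn n → ℝ}
    (hg : ∀ l, ContDiff ℝ ∞ (g l)) (p : Rn n × JetSpace n k) :
    Function.Surjective (fderiv ℝ (perturbedJet k g) p) := by
  have h1 : HasFDerivAt (perturbedJet k g) (fderiv ℝ (perturbedJet k g) p) (p.1, p.2) :=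
    ((contDiff_perturbedJet hg).differentiable (by simp) p).hasFDerivAt
  have h2 := h1.comp p.2 (hasFDerivAt_prodMk_right p.1 p.2)
  have h3 : HasFDerivAt (fun α => perturbedJet k g (p.1, α))
      (LinearMap.toContinuousLinearMap (polyJet (k := k) p.1)) p.2 :=
    (LinearMap.toContinuousLinearMap (polyJet (k := k) p.1)).hasFDerivAt.const_add (jet k g p.1)
  have h4 := h2.unique h3
  intro b
  obtain ⟨α, hα⟩ := polyJet_surjective p.1 b
  refine ⟨(0, α), ?_⟩
  rw [← hα]
  exact congrArg (fun T => T α) h4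

theorem exists_perturb_Z_eq_empty (hk : 2 ≤ k) (hkn : n + 1 ≤ k ^ 2)
    {g : Fin (n + 1) → Rn n → ℝ} (hg : ∀ l, ContDiff ℝ ∞ (g l)) {ε : ℝ} (hε : 0 < ε) :
    ∃ α : JetSpace n k, ‖α‖ < ε ∧ Z (perturb g α) (k - 1) = ∅ := by
  obtain ⟨μ, T, c, hT, -, hman, hcod, -⟩ := isManifoldCollection_badSet hk hkn
  set N := Fintype.card (Fin (n + 1) × MultiIdx n k) with hN
  have hNn : n + 1 ≤ N := succ_le_card_jetCoordinates n k
  let B : Set (JetSpace n k) := ⋃ i, Prod.snd '' (perturbedJet k g ⁻¹' T i)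
  -- Codimension at least n+1 in dimension n+N leaves at most N-1, and the projection to α is
  -- Lipschitz.
  have hB : dimH B ≤ ((N - 1 : ℕ) : ENNReal) := by
    rw [dimH_iUnion]
    refine iSup_le fun i => ?_
    refine (LipschitzWith.prod_snd.dimH_image_le _).trans ?_
    have h1 := ((hman i).preimage (contDiff_perturbedJet hg)
      (surjective_fderiv_perturbedJet hg)).dimH_le
    refine h1.trans (Nat.cast_le.2 ?_)
    rw [finrank_prod, finrank_euclideanSpace, finrank_euclideanSpace, Fintype.card_fin, ← hN]
    have := hcod i
    omega
  have hdense : Dense Bᶜ := by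
    apply dense_compl_of_dimH_lt_finrank
    refine hB.trans_lt (Nat.cast_lt.2 ?_)
    rw [finrank_euclideanSpace, ← hN]
    omega
  obtain ⟨α, hα, hαε⟩ := hdense.exists_dist_lt 0 hε
  refine ⟨α, by simpa using hαε, ?_⟩
  rw [eq_empty_iff_forall_notMem]
  intro x hx
  have hbad : jet k (perturb g α) x ∈ badSet n k :=
    ⟨perturb g α, x, contDiff_perturb hg α, rfl, hx⟩
  rw [hT, mem_iUnion] at hbad
  obtain ⟨i, hi⟩ := hbad
  rw [jet_perturb hg] at hi
  exact hα (mem_iUnion.2 ⟨i, (x, α), hi, rfl⟩)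

end Transversality

/-! ### Reduction to globally defined maps -/

section Localization

open scoped Manifold

/-- Multiply f by a smooth cut-off that is 1 near K and supported in a compact subset of Ω.
Agreement near K, not just on it, is what preserves derivatives. -/
theorem exists_contDiff_eventuallyEq {E : Type*} [NormedAddCommGroup E] [NormedSpace ℝ E]
    [FiniteDimensional ℝ E] {Ω K : Set E} (hΩ : IsOpen Ω) (hK : IsCompact K) (hKΩ : K ⊆ Ω)
    {f : E → ℝ} (hf : ContDiffOn ℝ ∞ f Ω) :
    ∃ f' : E → ℝ, ContDiff ℝ ∞ f' ∧ ∀ x ∈ K, f' =ᶠ[𝓝 x] f := by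
  obtain ⟨K', hK', hKK', hK'Ω⟩ := exists_compact_between hK hΩ hKΩ
  obtain ⟨χ, hχ1, hχ0, -⟩ := exists_contMDiffMap_one_nhds_of_subset_interior (n := ⊤)
    𝓘(ℝ, E) hK.isClosed hKK'
  have hχ : ContDiff ℝ ∞ χ := χ.contMDiff.contDiff
  refine ⟨fun x => χ x * f x, ?_, fun x hx => ?_⟩
  · rw [contDiff_iff_contDiffAt]
    intro x
    by_cases hx : x ∈ Ω
    · exact hχ.contDiffAt.mul (hf.contDiffAt (hΩ.mem_nhds hx))
    · have hx' : x ∈ K'ᶜ := fun h => hx (hK'Ω h)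
      refine (contDiffAt_const (c := (0 : ℝ))).congr_of_eventuallyEq ?_
      filter_upwards [hK'.isClosed.isOpen_compl.mem_nhds hx'] with y hy
      rw [hχ0 y hy, zero_mul]
  · filter_upwards [hχ1.filter_mono (nhds_le_nhdsSet hx)] with y hy
    rw [hy, one_mul]

theorem mem_Z_congr {n : ℕ} {g g' : Fin (n + 1) → Rn n → ℝ} {x : Rn n}
    (hgg : ∀ l, g l =ᶠ[𝓝 x] g' l) (m : ℕ) : x ∈ Z g m ↔ x ∈ Z g' m := by
  have hh : h g =ᶠ[𝓝 x] h g' := by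
    have h1 : ∀ᶠ y in 𝓝 x, ∀ l, g l =ᶠ[𝓝 y] g' l :=
      Filter.eventually_all.2 fun l => (hgg l).eventuallyEq_nhds
    filter_upwards [h1] with y hy
    have hd : ∀ l, fderiv ℝ (g l) y = fderiv ℝ (g' l) y := fun l => (hy l).fderiv_eq
    simp only [h, gradMatrix, pd, hd, fun l => (hy l).eq_of_nhds]
  induction m with
  | zero => simp only [Z, mem_ofPred_eq, hh.eq_of_nhds]
  | succ m ih => simp only [Z, mem_inter_iff, ih, mem_ofPred_eq, (hh.iteratedFDeriv ℝ _).eq_of_nhds]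

end Localization

/-- The derivatives of the matrix (∇g, g) are of second order, so they are jet coordinates only for
k ≥ 2. -/
theorem two_le_kk {n : ℕ} (hn : 1 ≤ n) : 2 ≤ kk n := by
  rw [kk]
  refine Nat.succ_le_of_lt (Nat.lt_ceil.2 ?_)
  rw [Nat.cast_one, Real.lt_sqrt (by norm_num)]
  have : (1 : ℝ) ≤ n := by exact_mod_cast hn
  linarith

theorem succ_le_kk_sq (n : ℕ) : n + 1 ≤ kk n ^ 2 := by
  have h1 : Real.sqrt ((n : ℝ) + 1) ≤ kk n := Nat.le_ceil _
  have h2 := (Real.sqrt_le_left (Nat.cast_nonneg _)).1 h1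
  exact_mod_cast h2

end DetGen

theorem mainTheorem7 (n : ℕ) (hn : 1 ≤ n) :
    DetGen.IsManifoldCollection (DetGen.badSet n (DetGen.kk n)) (n + 1) ∧
    ∀ (Ω : Set (DetGen.Rn n)) (g : Fin (n + 1) → DetGen.Rn n → ℝ) (K : Set (DetGen.Rn n)),
      IsOpen Ω → (∀ l, ContDiffOn ℝ ∞ (g l) Ω) → IsCompact K → K ⊆ Ω →
      ∀ ε : ℝ, 0 < ε → ∃ α : DetGen.JetSpace n (DetGen.kk n), ‖α‖ < ε ∧
        DetGen.Z (DetGen.perturb g α) (DetGen.kk n - 1) ∩ K = ∅ := by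
  have hk := DetGen.two_le_kk hn
  have hkn := DetGen.succ_le_kk_sq n
  refine ⟨DetGen.isManifoldCollection_badSet hk hkn, fun Ω g K hΩ hg hK hKΩ ε hε => ?_⟩
  choose g' hg' hgg' using fun l => DetGen.exists_contDiff_eventuallyEq hΩ hK hKΩ (hg l)
  obtain ⟨α, hα, hZ⟩ := DetGen.exists_perturb_Z_eq_empty hk hkn hg' hε
  refine ⟨α, hα, Set.eq_empty_iff_forall_notMem.2 ?_⟩
  rintro x ⟨hx, hxK⟩
  -- The added polynomial does not depend on g, so the α found for the global extension also serves
  -- g on K.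
  have hloc : ∀ l, DetGen.perturb g α l =ᶠ[nhds x] DetGen.perturb g' α l := fun l => by
    filter_upwards [hgg' l x hxK] with y hy
    simp only [DetGen.perturb, hy]
  rw [DetGen.mem_Z_congr hloc, hZ] at hx
  exact hx
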